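/- Let $\Bbbk$ be an algebraically closed field of characteristic $0$ and let $q\in\Bbbk^\times$ be a root of unity of multiplicative order $d\ge 2$. Let $\mathcal A$ be the infinite linear quiver, with vertices $g^i$ ($i\in\mathbb Z$) and exactly one arrow $g^i\to g^{i+1}$ for each $i$. Let $p_i^l$ be the path of length $l\ge 0$ starting at $g^i$, so that the paths $p_i^l$ form a basis of $\Bbbk\mathcal A$. Let $\Bbbk\mathcal A(q)$ be the graded Hopf algebra on the space $\Bbbk\mathcal A$ with unit $p_0^0$, multiplication, comultiplication and counit $$p_i^l\cdot p_j^m=q^{im}\binom{l+m}{l}_q\,p_{i+j}^{l+m},\qquad \Delta(p_i^l)=\sum_{a+b=l}p_{i+b}^{a}\otimes p_i^{b},\qquad \varepsilon(p_i^l)=\delta_{l,0},$$ where $\binom{l+m}{l}_q$ is the value at $q$ of the Gaussian binomial polynomial. Let $\mathcal D_q$ be the tensor category of finite dimensional right $\Bbbk\mathcal A(q)$-comodules, where $V\otimes W$ has the structure map $v\otimes w\mapsto v_0\otimes w_0\otimes v_1w_1$ in Sweedler notation. The Green ring $\mathcal{GR}(\mathcal D_q)$ is the free abelian group on the isomorphism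 classes $[V]$ of objects of $\mathcal D_q$, modulo the relations $[V\oplus W]=[V]+[W]$, with the multiplication $[V]\cdot[W]=[V\otimes W]$. Then there is an isomorphism of rings $$\mathcal{GR}(\mathcal D_q)\;\cong\;\mathbb Z[x,x^{-1},y,z]/J,$$ where $J$ is the ideal of $\mathbb Z[x,x^{-1},y,z]$ generated by the single element $$(y-x-1)\sum_{i=0}^{\lfloor (d-1)/2\rfloor}(-1)^i\binom{d-1-i}{i}x^i y^{d-1-2i}.$$ -/

import Mathlib

open scoped TensorProduct

/-! ### Gaussian binomials -/

section Gauss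

variable {k : Type*} [CommRing k]

/-- The `q`-integer `n_q = 1 + q + ⋯ + q ^ (n - 1)`. -/
def qInt (q : k) (n : ℕ) : k := ∑ i ∈ Finset.range n, q ^ i

/-- The `q`-factorial `n!_q = 1_q 2_q ⋯ n_q`. -/
def qFactorial (q : k) (n : ℕ) : k := ∏ i ∈ Finset.range n, qInt q (i + 1)

/-- The Gaussian binomial coefficient, i.e. the value at `q` of the polynomial
`n!_X / (j!_X (n - j)!_X)`, given by the `q`-Pascal rule (so that it also makes sense when
`q` is a root of unity and the quotient is `0 / 0`); see `gaussBinom_mul_qFactorial`. -/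
def gaussBinom (q : k) : ℕ → ℕ → k
  | _, 0 => 1
  | 0, _ + 1 => 0
  | n + 1, j + 1 => gaussBinom q n j + q ^ (j + 1) * gaussBinom q n (j + 1)

@[simp] theorem gaussBinom_zero_right (q : k) (n : ℕ) : gaussBinom q n 0 = 1 := by
  cases n <;> rfl

theorem gaussBinom_eq_zero (q : k) {n j : ℕ} (h : n < j) : gaussBinom q n j = 0 := by
  induction n generalizing j with
  | zero => cases j with
    | zero => omega
    | succ j => rfl
  | succ n ih => cases j with
    | zero => omega
    | succ j => simp [gaussBinom, ih (show n < j by omega), ih (show n < j + 1 by omega)]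

@[simp] theorem gaussBinom_self (q : k) (n : ℕ) : gaussBinom q n n = 1 := by
  induction n with
  | zero => rfl
  | succ n ih => simp [gaussBinom, ih, gaussBinom_eq_zero]

theorem gaussBinom_pascal (q : k) (l m : ℕ) :
    gaussBinom q (l + 1 + (m + 1)) (l + 1)
      = gaussBinom q (l + (m + 1)) l + q ^ (l + 1) * gaussBinom q (l + 1 + m) (l + 1) := by
  have h1 : l + 1 + (m + 1) = (l + m + 1) + 1 := by omega
  have h2 : l + (m + 1) = l + m + 1 := by omega
  have h3 : l + 1 + m = l + m + 1 := by omega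
  rw [h1, h2, h3]; rfl

theorem qInt_add (q : k) (l m : ℕ) : qInt q (l + m) = qInt q l + q ^ l * qInt q m := by
  simp only [qInt, Finset.sum_range_add, Finset.mul_sum, pow_add]

/-- The polynomial identity that characterizes the Gaussian binomial coefficients. -/
theorem gaussBinom_mul_qFactorial (q : k) (l m : ℕ) :
    gaussBinom q (l + m) l * (qFactorial q l * qFactorial q m) = qFactorial q (l + m) := by
  have hs : ∀ n, qFactorial q (n + 1) = qFactorial q n * qInt q (n + 1) := fun n =>
    Finset.prod_range_succ _ _
  have h0 : qFactorial q 0 = 1 := Finset.prod_range_zero _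
  induction l generalizing m with
  | zero => simp [h0]
  | succ l ihl =>
    induction m with
    | zero => simp [h0]
    | succ m ihm =>
      have e : l + 1 + (m + 1) = (l + (m + 1)) + 1 := by omega
      have e2 : l + 1 + m = l + (m + 1) := by omega
      have h := ihl (m + 1)
      have e3 : qInt q (l + (m + 1) + 1) = qInt q (l + 1) + q ^ (l + 1) * qInt q (m + 1) := by
        rw [← qInt_add, e]
      rw [gaussBinom_pascal, e, hs (l + (m + 1)), e3, mul_add (qFactorial q (l + (m + 1)))]
      nth_rewrite 1 [← h]
      rw [← e2, ← ihm, hs l, hs m]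
      ring

/-- Both sides are the Gaussian trinomial coefficient. -/
theorem gaussBinom_trinomial (q : k) (l m n : ℕ) :
    gaussBinom q (l + m) l * gaussBinom q (l + m + n) (l + m)
      = gaussBinom q (m + n) m * gaussBinom q (l + (m + n)) l := by
  induction hN : l + m + n using Nat.strong_induction_on generalizing l m n with
  | _ N ih =>
  subst hN
  rcases l with _ | l
  · simp
  rcases m with _ | m
  · simp
  rcases n with _ | n
  · simp
  have h1 := ih _ (by omega) l (m + 1) (n + 1) rfl
  have h2 := ih _ (by omega) (l + 1) m (n + 1) rfl
  have h3 := ih _ (by omega) (l + 1) (m + 1) n rfl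
  have p1 := gaussBinom_pascal q l m
  have p2 := gaussBinom_pascal q m n
  have p3 := gaussBinom_pascal q (l + m + 1) n
  have p4 := gaussBinom_pascal q l (m + n + 1)
  have a1 : l + 1 + (m + 1) = l + m + 1 + 1 := by omega
  have a2 : l + (m + 1) = l + m + 1 := by omega
  have a3 : l + 1 + m = l + m + 1 := by omega
  have a4 : m + 1 + (n + 1) = m + n + 1 + 1 := by omega
  have a5 : m + (n + 1) = m + n + 1 := by omega
  have a6 : m + 1 + n = m + n + 1 := by omega
  simp only [a1, a2, a3, a4, a5, a6] at h1 h2 h3 p1 p2 p3 p4 ⊢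
  have b1 : l + m + 1 + 1 + n = l + m + 1 + (n + 1) := by omega
  have b2 : l + (m + n + 1 + 1) = l + m + 1 + (n + 1) := by omega
  have b3 : l + 1 + (m + n + 1) = l + m + 1 + (n + 1) := by omega
  have b4 : l + 1 + (m + n + 1 + 1) = l + m + 1 + 1 + (n + 1) := by omega
  simp only [b1, b2, b3, b4] at h1 h2 h3 p1 p2 p3 p4 ⊢
  linear_combination (gaussBinom q (l + m + 1 + 1 + (n + 1)) (l + m + 1 + 1)) * p1
    - (gaussBinom q (l + m + 1 + 1 + (n + 1)) (l + 1)) * p2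
    + (gaussBinom q (l + m + 1) l + q ^ (l + 1) * gaussBinom q (l + m + 1) (l + 1)) * p3
    - (gaussBinom q (m + n + 1) m + q ^ (m + 1) * gaussBinom q (m + n + 1) (m + 1)) * p4
    + h1 + q ^ (l + 1) * h2 + q ^ (l + m + 2) * h3
    - q ^ (l + m + 2) * gaussBinom q (l + m + 1 + (n + 1)) (l + m + 1 + 1) * p1
    + gaussBinom q (l + m + 1 + (n + 1)) l * p2

/-- The `q`-Vandermonde identity, in the form in which it expresses that the comultiplication of
paths is multiplicative. -/
theorem gaussBinom_vandermonde {M : Type*} [AddCommGroup M] [Module k M] (q : k) (l m : ℕ)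
    (F : ℕ → ℕ → M) :
    ∑ x ∈ Finset.HasAntidiagonal.antidiagonal l, ∑ y ∈ Finset.HasAntidiagonal.antidiagonal m,
      (q ^ (x.2 * y.1) * (gaussBinom q (x.1 + y.1) x.1 * gaussBinom q (x.2 + y.2) x.2)) •
        F (x.1 + y.1) (x.2 + y.2)
      = gaussBinom q (l + m) l •
          ∑ z ∈ Finset.HasAntidiagonal.antidiagonal (l + m), F z.1 z.2 := by
  induction hN : l + m using Nat.strong_induction_on generalizing l m F with
  | _ N ih =>
  subst hN
  rcases l with _ | l
  · simp
  rcases m with _ | m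
  · simp
  have h1 := ih _ (by omega) l (m + 1) (fun u c => F (u + 1) c) rfl
  have h2 := ih _ (by omega) (l + 1) m (fun u c => F (u + 1) c) rfl
  have e1 : l + 1 + (m + 1) = (l + (m + 1)) + 1 := by omega
  have e2 : l + 1 + m = l + (m + 1) := by omega
  have hR : gaussBinom q (l + 1 + (m + 1)) (l + 1) •
      ∑ z ∈ Finset.HasAntidiagonal.antidiagonal (l + 1 + (m + 1)), F z.1 z.2
      = gaussBinom q (l + 1 + (m + 1)) (l + 1) • F 0 (l + 1 + (m + 1))
        + (gaussBinom q (l + (m + 1)) l •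
            ∑ z ∈ Finset.HasAntidiagonal.antidiagonal (l + (m + 1)), F (z.1 + 1) z.2
          + q ^ (l + 1) • (gaussBinom q (l + 1 + m) (l + 1) •
            ∑ z ∈ Finset.HasAntidiagonal.antidiagonal (l + 1 + m), F (z.1 + 1) z.2)) := by
    rw [e2, e1, Finset.Nat.sum_antidiagonal_succ, smul_add, ← e1, gaussBinom_pascal, e2]
    congr 1
    rw [add_smul, mul_smul]
  rw [hR, ← h1, ← h2]
  simp only [Finset.Nat.sum_antidiagonal_succ, Finset.sum_add_distrib, smul_add,
    Finset.smul_sum, zero_add, mul_zero, pow_zero, one_mul, gaussBinom_zero_right, smul_smul]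
  have key : ∀ x ∈ Finset.HasAntidiagonal.antidiagonal l,
      ∀ y ∈ Finset.HasAntidiagonal.antidiagonal m,
      (q ^ (x.2 * (y.1 + 1)) * (gaussBinom q (x.1 + 1 + (y.1 + 1)) (x.1 + 1) *
          gaussBinom q (x.2 + y.2) x.2)) • F (x.1 + 1 + (y.1 + 1)) (x.2 + y.2)
      = (q ^ (x.2 * (y.1 + 1)) * (gaussBinom q (x.1 + (y.1 + 1)) x.1 *
          gaussBinom q (x.2 + y.2) x.2)) • F (x.1 + (y.1 + 1) + 1) (x.2 + y.2)
        + (q ^ (l + 1) * (q ^ (x.2 * y.1) * (gaussBinom q (x.1 + 1 + y.1) (x.1 + 1) *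
          gaussBinom q (x.2 + y.2) x.2))) • F (x.1 + 1 + y.1 + 1) (x.2 + y.2) := by
    intro x hx y hy
    rw [Finset.HasAntidiagonal.mem_antidiagonal] at hx
    have f1 : x.1 + (y.1 + 1) + 1 = x.1 + 1 + (y.1 + 1) := by omega
    have f2 : x.1 + 1 + y.1 + 1 = x.1 + 1 + (y.1 + 1) := by omega
    rw [f1, f2, ← add_smul, gaussBinom_pascal, ← hx]
    congr 1
    ring
  rw [Finset.sum_congr rfl fun x hx => Finset.sum_congr rfl (key x hx)]
  simp only [Finset.sum_add_distrib]
  have hx : ∀ y ∈ Finset.HasAntidiagonal.antidiagonal m,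
      (q ^ ((l + 1) * (y.1 + 1)) * gaussBinom q (l + 1 + y.2) (l + 1)) •
        F (y.1 + 1) (l + 1 + y.2)
      = (q ^ (l + 1) * (q ^ ((l + 1) * y.1) * gaussBinom q (l + 1 + y.2) (l + 1))) •
        F (y.1 + 1) (l + 1 + y.2) := by
    intro y _
    congr 1
    ring
  rw [Finset.sum_congr rfl hx]
  simp only [add_zero, gaussBinom_self, one_mul]
  abel

theorem gaussBinom_alternating_aux (q : k) (l : ℕ) (X : k) :
    ∑ x ∈ Finset.HasAntidiagonal.antidiagonal (l + 1),
      (-1) ^ x.1 * q ^ (x.1.choose 2) * gaussBinom q (x.1 + x.2) x.1 * X ^ x.1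
    = (1 - X) * ∑ x ∈ Finset.HasAntidiagonal.antidiagonal l,
      (-1) ^ x.1 * q ^ (x.1.choose 2) * gaussBinom q (x.1 + x.2) x.1 * (q * X) ^ x.1 := by
  have h1 : ∑ x ∈ Finset.HasAntidiagonal.antidiagonal (l + 1),
      (-1) ^ x.1 * q ^ (x.1.choose 2) * gaussBinom q (x.1 + x.2) x.1 * X ^ x.1
      = ∑ x ∈ Finset.HasAntidiagonal.antidiagonal (l + 1),
        (-1) ^ x.1 * q ^ (x.1.choose 2) * (q ^ x.1 * gaussBinom q l x.1) * X ^ x.1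
        + ∑ x ∈ Finset.HasAntidiagonal.antidiagonal l,
        (-1) ^ (x.1 + 1) * q ^ ((x.1 + 1).choose 2) * gaussBinom q l x.1 * X ^ (x.1 + 1) := by
    rw [Finset.Nat.sum_antidiagonal_succ, Finset.Nat.sum_antidiagonal_succ, add_assoc,
      ← Finset.sum_add_distrib]
    congr 1
    · simp
    · refine Finset.sum_congr rfl fun x hx => ?_
      rw [Finset.HasAntidiagonal.mem_antidiagonal] at hx
      have : x.1 + 1 + x.2 = l + 1 := by omega
      simp only [this, gaussBinom]
      ring
  rw [h1, Finset.Nat.sum_antidiagonal_succ']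
  simp only [gaussBinom_eq_zero q (Nat.lt_succ_self l), mul_zero, zero_mul, zero_add]
  rw [Finset.mul_sum, ← Finset.sum_add_distrib]
  refine Finset.sum_congr rfl fun x hx => ?_
  rw [Finset.HasAntidiagonal.mem_antidiagonal] at hx
  rw [hx, Nat.choose_succ_succ' x.1 1, Nat.choose_one_right]
  ring

theorem gaussBinom_alternating (q : k) {l : ℕ} (hl : l ≠ 0) :
    ∑ x ∈ Finset.HasAntidiagonal.antidiagonal l,
      (-1) ^ x.1 * q ^ (x.1.choose 2) * gaussBinom q (x.1 + x.2) x.1 = 0 := by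
  obtain ⟨l, rfl⟩ := Nat.exists_eq_succ_of_ne_zero hl
  simpa using gaussBinom_alternating_aux q l 1

theorem gaussBinom_alternating' (q : k) {l : ℕ} (hl : l ≠ 0) :
    ∑ x ∈ Finset.HasAntidiagonal.antidiagonal l,
      (-1) ^ x.2 * q ^ (x.2.choose 2) * gaussBinom q l x.1 = 0 := by
  obtain ⟨l, rfl⟩ := Nat.exists_eq_succ_of_ne_zero hl
  have step : ∀ l, ∑ x ∈ Finset.HasAntidiagonal.antidiagonal (l + 1),
      (-1) ^ x.2 * q ^ (x.2.choose 2) * gaussBinom q (l + 1) x.1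
      = (1 - q ^ l) * ∑ x ∈ Finset.HasAntidiagonal.antidiagonal l,
        (-1) ^ x.2 * q ^ (x.2.choose 2) * gaussBinom q l x.1 := by
    intro l
    have h1 : ∑ x ∈ Finset.HasAntidiagonal.antidiagonal (l + 1),
        (-1) ^ x.2 * q ^ (x.2.choose 2) * gaussBinom q (l + 1) x.1
        = ∑ x ∈ Finset.HasAntidiagonal.antidiagonal (l + 1),
          (-1) ^ x.2 * q ^ (x.2.choose 2) * (q ^ x.1 * gaussBinom q l x.1)
          + ∑ x ∈ Finset.HasAntidiagonal.antidiagonal l,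
          (-1) ^ x.2 * q ^ (x.2.choose 2) * gaussBinom q l x.1 := by
      rw [Finset.Nat.sum_antidiagonal_succ, Finset.Nat.sum_antidiagonal_succ, add_assoc,
        ← Finset.sum_add_distrib]
      congr 1
      · simp
      · refine Finset.sum_congr rfl fun x _ => ?_
        simp only [gaussBinom]
        ring
    rw [h1, Finset.Nat.sum_antidiagonal_succ']
    simp only [gaussBinom_eq_zero q (Nat.lt_succ_self l), mul_zero, zero_add]
    rw [Finset.mul_sum, ← Finset.sum_add_distrib]
    refine Finset.sum_congr rfl fun x hx => ?_
    rw [Finset.HasAntidiagonal.mem_antidiagonal] at hx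
    rw [← hx, Nat.choose_succ_succ' x.2 1, Nat.choose_one_right]
    ring
  induction l with
  | zero => simp [step]
  | succ l ih => rw [step, ih (Nat.succ_ne_zero l), mul_zero]

end Gauss

/-! ### The graded Hopf algebra of the infinite linear quiver -/

noncomputable section

/-- The path space of the infinite linear quiver, which has vertices `g ^ i` (`i : ℤ`) and exactly
one arrow `g ^ i ⟶ g ^ (i + 1)` for each `i`. A path is determined by its source `i` and its length
`l`, so the space of finitely supported functions on `ℤ × ℕ` is the space spanned by the paths.
The unit `q` is the parameter of the multiplication that is put on this space below. -/
def LinearQuiverHopf (k : Type*) [Field k] (_q : kˣ) : Type _ := (ℤ × ℕ) →₀ k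

namespace LinearQuiverHopf

section

variable {k : Type*} [Field k] {q : kˣ}

instance : AddCommGroup (LinearQuiverHopf k q) := inferInstanceAs (AddCommGroup ((ℤ × ℕ) →₀ k))

instance : Module k (LinearQuiverHopf k q) := inferInstanceAs (Module k ((ℤ × ℕ) →₀ k))

/-- The path with source `g ^ i` and length `l`; its target is `g ^ (i + l)`. -/
def path (q : kˣ) (i : ℤ) (l : ℕ) : LinearQuiverHopf k q :=
  Finsupp.single (i, l) (1 : k)

/-- The linear map with prescribed values on paths. -/
def lift {M : Type*} [AddCommGroup M] [Module k M] (f : ℤ → ℕ → M) :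
    LinearQuiverHopf k q →ₗ[k] M :=
  Finsupp.linearCombination k (fun a : ℤ × ℕ => f a.1 a.2)

@[simp] theorem lift_path {M : Type*} [AddCommGroup M] [Module k M] (f : ℤ → ℕ → M)
    (i : ℤ) (l : ℕ) : lift f (path q i l) = f i l := by
  have := Finsupp.linearCombination_single k (v := fun a : ℤ × ℕ => f a.1 a.2) (1 : k) (i, l)
  rw [one_smul] at this
  exact this

theorem path_induction {P : LinearQuiverHopf k q → Prop} (x : LinearQuiverHopf k q)
    (path : ∀ i l, P (path q i l)) (add : ∀ x y, P x → P y → P (x + y))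
    (smul : ∀ (c : k) x, P x → P (c • x)) : P x := by
  refine Finsupp.induction_linear (motive := P) x ?_ add ?_
  · have := smul 0 _ (path 0 0)
    rwa [zero_smul] at this
  · rintro ⟨i, l⟩ c
    have := smul c _ (path i l)
    have e : c • LinearQuiverHopf.path q i l = (Finsupp.single (i, l) c : (ℤ × ℕ) →₀ k) := by
      refine (Finsupp.smul_single c (i, l) (1 : k)).trans ?_
      rw [smul_eq_mul, mul_one]
    rwa [e] at this

theorem hom_ext {M : Type*} [AddCommGroup M] [Module k M] {f g : LinearQuiverHopf k q →ₗ[k] M}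
    (h : ∀ i l, f (path q i l) = g (path q i l)) : f = g := by
  ext x
  induction x using path_induction with
  | path i l => exact h i l
  | add x y hx hy => rw [map_add, map_add, hx, hy]
  | smul c x hx => rw [map_smul, map_smul, hx]

/-- The multiplication of paths
`p_i^l · p_j^m = q ^ (i m) * binom(l + m, l)_q • p_{i + j}^{l + m}`, extended bilinearly. -/
def mulMap : LinearQuiverHopf k q →ₗ[k] LinearQuiverHopf k q →ₗ[k] LinearQuiverHopf k q :=
  lift fun i l => lift fun j m =>
    ((q : k) ^ (i * m) * gaussBinom (q : k) (l + m) l) • path q (i + j) (l + m)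

instance : Mul (LinearQuiverHopf k q) := ⟨fun x y => mulMap x y⟩

/-- The unit is the vertex `g ^ 0`. -/
instance : One (LinearQuiverHopf k q) := ⟨path q 0 0⟩

theorem one_eq : (1 : LinearQuiverHopf k q) = path q 0 0 := rfl

theorem mul_eq (x y : LinearQuiverHopf k q) : x * y = mulMap x y := rfl

theorem path_mul_path (i j : ℤ) (l m : ℕ) :
    path q i l * path q j m
      = ((q : k) ^ (i * m) * gaussBinom (q : k) (l + m) l) • path q (i + j) (l + m) := by
  simp [mul_eq, mulMap]

theorem smul_mul' (c : k) (x y : LinearQuiverHopf k q) : c • x * y = c • (x * y) := by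
  simp [mul_eq]

theorem mul_smul' (c : k) (x y : LinearQuiverHopf k q) : x * c • y = c • (x * y) := by
  simp [mul_eq]

theorem add_mul' (x y z : LinearQuiverHopf k q) : (x + y) * z = x * z + y * z := by
  simp [mul_eq]

theorem mul_add' (x y z : LinearQuiverHopf k q) : x * (y + z) = x * y + x * z := by
  simp [mul_eq]

theorem mul_assoc' (x y z : LinearQuiverHopf k q) : x * y * z = x * (y * z) := by
  induction x using path_induction with
  | add x x' hx hx' => simp only [add_mul', hx, hx']
  | smul c x hx => simp only [smul_mul', hx]
  | path i l =>
  induction y using path_induction with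
  | add y y' hy hy' => simp only [add_mul', mul_add', hy, hy']
  | smul c y hy => simp only [smul_mul', mul_smul', hy]
  | path j m =>
  induction z using path_induction with
  | add z z' hz hz' => simp only [mul_add', hz, hz']
  | smul c z hz => simp only [mul_smul', hz]
  | path h n =>
  have hq : (q : k) ≠ 0 := q.ne_zero
  have e := gaussBinom_trinomial (q : k) l m n
  simp only [path_mul_path, smul_mul', mul_smul', smul_smul, add_assoc]
  rw [add_assoc] at e
  congr 1
  push_cast
  rw [mul_add, add_mul, zpow_add₀ hq, zpow_add₀ hq]
  linear_combination (q : k) ^ (i * (m : ℤ)) * (q : k) ^ (i * (n : ℤ)) * (q : k) ^ (j * (n : ℤ)) * e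

theorem one_mul' (x : LinearQuiverHopf k q) : 1 * x = x := by
  induction x using path_induction with
  | add x y hx hy => rw [mul_add', hx, hy]
  | smul c x hx => rw [mul_smul', hx]
  | path i l => simp [one_eq, path_mul_path]

theorem mul_one' (x : LinearQuiverHopf k q) : x * 1 = x := by
  induction x using path_induction with
  | add x y hx hy => rw [add_mul', hx, hy]
  | smul c x hx => rw [smul_mul', hx]
  | path i l => simp [one_eq, path_mul_path]

instance : Ring (LinearQuiverHopf k q) where
  __ := (inferInstance : AddCommGroup (LinearQuiverHopf k q))
  mul := (· * ·)
  one := 1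
  left_distrib := mul_add'
  right_distrib := add_mul'
  zero_mul x := by simp [mul_eq]
  mul_zero x := by simp [mul_eq]
  mul_assoc := mul_assoc'
  one_mul := one_mul'
  mul_one := mul_one'

instance : Algebra k (LinearQuiverHopf k q) := Algebra.ofModule smul_mul' mul_smul'

/-- The path coalgebra: comultiplication splits a path in all possible ways, the first tensor
factor being the final part of the path, and the counit is `1` on vertices and `0` on paths of
positive length. -/
instance : CoalgebraStruct k (LinearQuiverHopf k q) where
  comul := lift fun i l =>
    ∑ x ∈ Finset.HasAntidiagonal.antidiagonal l, path q (i + x.2) x.1 ⊗ₜ[k] path q i x.2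
  counit := lift fun _ l => if l = 0 then 1 else 0

theorem comul_path (i : ℤ) (l : ℕ) :
    CoalgebraStruct.comul (R := k) (path q i l)
      = ∑ x ∈ Finset.HasAntidiagonal.antidiagonal l, path q (i + x.2) x.1 ⊗ₜ[k] path q i x.2 :=
  lift_path _ i l

theorem counit_path (i : ℤ) (l : ℕ) :
    CoalgebraStruct.counit (R := k) (path q i l) = if l = 0 then 1 else 0 :=
  lift_path _ i l

instance : Coalgebra k (LinearQuiverHopf k q) where
  coassoc := by
    refine hom_ext fun i l => ?_
    simp only [LinearMap.comp_apply, comul_path, map_sum, LinearMap.rTensor_tmul,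
      LinearMap.lTensor_tmul, TensorProduct.sum_tmul, TensorProduct.tmul_sum,
      LinearEquiv.coe_coe, TensorProduct.assoc_tmul]
    rw [Finset.sum_sigma', Finset.sum_sigma']
    refine Finset.sum_bij' (fun x _ => ⟨(x.2.1, x.2.2 + x.1.2), (x.2.2, x.1.2)⟩)
      (fun x _ => ⟨(x.1.1 + x.2.1, x.2.2), (x.1.1, x.2.1)⟩) ?_ ?_ ?_ ?_ ?_
    all_goals
      rintro ⟨⟨a, b⟩, ⟨c, d⟩⟩ h
      simp only [Finset.mem_sigma, Finset.HasAntidiagonal.mem_antidiagonal] at h ⊢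
      obtain ⟨h1, h2⟩ := h
    · exact ⟨by omega, trivial⟩
    · exact ⟨by omega, trivial⟩
    · subst h2; rfl
    · subst h2; rfl
    · subst h2
      congr 2
      push_cast
      ring
  rTensor_counit_comp_comul := by
    refine hom_ext fun i l => ?_
    simp only [LinearMap.comp_apply, comul_path, map_sum, LinearMap.rTensor_tmul, counit_path]
    rw [Finset.sum_eq_single (0, l)]
    · simp
    · rintro ⟨a, b⟩ h hne
      rw [Finset.HasAntidiagonal.mem_antidiagonal] at h
      have : a ≠ 0 := by rintro rfl; simp_all
      simp [this]
    · simp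
  lTensor_counit_comp_comul := by
    refine hom_ext fun i l => ?_
    simp only [LinearMap.comp_apply, comul_path, map_sum, LinearMap.lTensor_tmul, counit_path]
    rw [Finset.sum_eq_single (l, 0)]
    · simp
    · rintro ⟨a, b⟩ h hne
      rw [Finset.HasAntidiagonal.mem_antidiagonal] at h
      have : b ≠ 0 := by rintro rfl; simp_all
      simp [this]
    · simp

theorem counit_mul' (x y : LinearQuiverHopf k q) :
    CoalgebraStruct.counit (R := k) (x * y)
      = CoalgebraStruct.counit (R := k) x * CoalgebraStruct.counit (R := k) y := by
  induction x using path_induction with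
  | add x x' hx hx' => simp only [add_mul, map_add, hx, hx']
  | smul c x hx => simp only [smul_mul_assoc, map_smul, hx]
  | path i l =>
  induction y using path_induction with
  | add y y' hy hy' => simp only [mul_add, map_add, hy, hy']
  | smul c y hy => simp only [mul_smul_comm, map_smul, hy]
  | path j m =>
  simp only [path_mul_path, map_smul, counit_path]
  rcases l with _ | l <;> rcases m with _ | m <;> simp

theorem comul_mul' (x y : LinearQuiverHopf k q) :
    CoalgebraStruct.comul (R := k) (x * y)
      = CoalgebraStruct.comul (R := k) x * CoalgebraStruct.comul (R := k) y := by
  induction x using path_induction with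
  | add x x' hx hx' => simp only [add_mul, map_add, hx, hx']
  | smul c x hx => simp only [smul_mul_assoc, map_smul, hx]
  | path i l =>
  induction y using path_induction with
  | add y y' hy hy' => simp only [mul_add, map_add, hy, hy']
  | smul c y hy => simp only [mul_smul_comm, map_smul, hy]
  | path j m =>
  have hq : (q : k) ≠ 0 := q.ne_zero
  simp only [path_mul_path, map_smul, comul_path, Finset.sum_mul_sum,
    Algebra.TensorProduct.tmul_mul_tmul]
  have h := gaussBinom_vandermonde (q : k) l m
    (fun u c => path q (i + j + c) u ⊗ₜ[k] path q (i + j) c)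
  rw [mul_smul, ← h, Finset.smul_sum]
  refine Finset.sum_congr rfl fun x _ => ?_
  rw [Finset.smul_sum]
  refine Finset.sum_congr rfl fun y hy => ?_
  rw [Finset.HasAntidiagonal.mem_antidiagonal] at hy
  rw [TensorProduct.smul_tmul_smul, smul_smul]
  have e : i + j + ((x.2 + y.2 : ℕ) : ℤ) = i + x.2 + (j + y.2) := by push_cast; ring
  rw [e]
  congr 1
  have e2 : i * (m : ℤ) = i * y.1 + i * y.2 := by rw [← hy]; push_cast; ring
  have e3 : (i + (x.2 : ℤ)) * y.1 = i * y.1 + ((x.2 * y.1 : ℕ) : ℤ) := by push_cast; ring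
  rw [e2, e3, zpow_add₀ hq, zpow_add₀ hq, zpow_natCast]
  ring

instance : Bialgebra k (LinearQuiverHopf k q) :=
  Bialgebra.mk' k (LinearQuiverHopf k q)
    (by rw [one_eq]; simp [counit_path])
    (fun {a b} => counit_mul' a b)
    (by rw [one_eq]; simp [comul_path, Algebra.TensorProduct.one_def, one_eq])
    (fun {a b} => comul_mul' a b)

/-- The antipode `S(p_i^l) = (-1) ^ l * q ^ (l (l - 1) / 2 - l (i + l)) • p_{-i-l}^l`. -/
instance : HopfAlgebra k (LinearQuiverHopf k q) where
  antipode := lift fun i l =>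
    ((-1) ^ l * ((q : k) ^ (l.choose 2) * (q : k) ^ (-(l * (i + l)) : ℤ))) • path q (-i - l) l
  mul_antipode_rTensor_comul := by
    have hq : (q : k) ≠ 0 := q.ne_zero
    refine hom_ext fun i l => ?_
    simp only [LinearMap.comp_apply, comul_path, map_sum, LinearMap.rTensor_tmul, lift_path,
      LinearMap.mul'_apply, smul_mul_assoc, path_mul_path, smul_smul, counit_path,
      Algebra.linearMap_apply]
    rcases eq_or_ne l 0 with rfl | hl
    · simp [one_eq]
    rw [if_neg hl, map_zero]
    have h := gaussBinom_alternating (q : k) hl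
    have h' : ((q : k) ^ (-(l * (i + l)) : ℤ) * ∑ x ∈ Finset.HasAntidiagonal.antidiagonal l,
      (-1) ^ x.1 * (q : k) ^ (x.1.choose 2) * gaussBinom (q : k) (x.1 + x.2) x.1) •
        path q (-l) l = 0 := by rw [h, mul_zero, zero_smul]
    rw [Finset.mul_sum, Finset.sum_smul] at h'
    refine Eq.trans (Finset.sum_congr rfl fun x hx => ?_) h'
    rw [Finset.HasAntidiagonal.mem_antidiagonal] at hx
    have e1 : -(i + (x.2 : ℤ)) - x.1 + i = -(l : ℤ) := by rw [← hx]; push_cast; ring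
    rw [e1]
    have e2 : (-(l * (i + l)) : ℤ)
        = -(x.1 * (i + x.2 + x.1)) + (-(i + (x.2 : ℤ)) - x.1) * x.2 := by
      rw [← hx]; push_cast; ring
    rw [e2, zpow_add₀ hq, hx]
    congr 1
    ring
  mul_antipode_lTensor_comul := by
    have hq : (q : k) ≠ 0 := q.ne_zero
    refine hom_ext fun i l => ?_
    simp only [LinearMap.comp_apply, comul_path, map_sum, LinearMap.lTensor_tmul, lift_path,
      LinearMap.mul'_apply, mul_smul_comm, path_mul_path, smul_smul, counit_path,
      Algebra.linearMap_apply]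
    rcases eq_or_ne l 0 with rfl | hl
    · simp [one_eq]
    rw [if_neg hl, map_zero]
    have h := gaussBinom_alternating' (q : k) hl
    have h' : (∑ x ∈ Finset.HasAntidiagonal.antidiagonal l,
      (-1) ^ x.2 * (q : k) ^ (x.2.choose 2) * gaussBinom (q : k) l x.1) •
        path q 0 l = 0 := by rw [h, zero_smul]
    rw [Finset.sum_smul] at h'
    refine Eq.trans (Finset.sum_congr rfl fun x hx => ?_) h'
    rw [Finset.HasAntidiagonal.mem_antidiagonal] at hx
    have e1 : i + (x.2 : ℤ) + (-i - x.2) = 0 := by ring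
    have e2 : (-(x.2 * (i + x.2)) : ℤ) = -((i + (x.2 : ℤ)) * x.2) := by ring
    rw [e1, e2, zpow_neg, hx]
    congr 1
    have hz : (q : k) ^ ((i + (x.2 : ℤ)) * x.2) ≠ 0 := zpow_ne_zero _ hq
    field_simp

end

end LinearQuiverHopf

end

/-! ### Finite dimensional comodules and the Green ring -/

universe u v

noncomputable section

/-- A finite dimensional right comodule over the bialgebra `H`. -/
structure FDComod (k : Type u) [Field k] (H : Type v) [Ring H] [Bialgebra k H] where
  /-- The underlying vector space. -/
  carrier : Type u
  [addCommGroup : AddCommGroup carrier]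
  [module : Module k carrier]
  [finite : FiniteDimensional k carrier]
  /-- The comodule structure map. -/
  coact : carrier →ₗ[k] carrier ⊗[k] H
  coassoc : (TensorProduct.assoc k carrier H H).toLinearMap ∘ₗ coact.rTensor H ∘ₗ coact
    = (CoalgebraStruct.comul (R := k) (A := H)).lTensor carrier ∘ₗ coact
  counit : (TensorProduct.rid k carrier).toLinearMap ∘ₗ
    (CoalgebraStruct.counit (R := k) (A := H)).lTensor carrier ∘ₗ coact = LinearMap.id

namespace FDComod

attribute [instance] FDComod.addCommGroup FDComod.module FDComod.finite

section

variable {k : Type u} [Field k]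

/-- The linear map `(V ⊗ A) ⊗ (W ⊗ A) → (V ⊗ W) ⊗ A`,
`(v ⊗ a) ⊗ (w ⊗ b) ↦ (v ⊗ w) ⊗ a b`. -/
def mulCoeff (V W A : Type*) [AddCommGroup V] [Module k V] [AddCommGroup W] [Module k W]
    [Ring A] [Algebra k A] : (V ⊗[k] A) ⊗[k] (W ⊗[k] A) →ₗ[k] (V ⊗[k] W) ⊗[k] A :=
  (LinearMap.mul' k A).lTensor (V ⊗[k] W) ∘ₗ
    (TensorProduct.tensorTensorTensorComm k V A W A).toLinearMap

section

variable {U V W V' W' A B : Type*} [AddCommGroup U] [Module k U] [AddCommGroup V] [Module k V]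
  [AddCommGroup W] [Module k W] [AddCommGroup V'] [Module k V'] [AddCommGroup W'] [Module k W']
  [Ring A] [Algebra k A] [Ring B] [Algebra k B]

@[simp] theorem mulCoeff_tmul (v : V) (w : W) (a b : A) :
    mulCoeff (k := k) V W A ((v ⊗ₜ a) ⊗ₜ (w ⊗ₜ b)) = (v ⊗ₜ w) ⊗ₜ (a * b) := by
  simp [mulCoeff]

theorem lTensor_mulCoeff (f : A →ₐ[k] B) (x : V ⊗[k] A) (y : W ⊗[k] A) :
    f.toLinearMap.lTensor (V ⊗[k] W) (mulCoeff V W A (x ⊗ₜ y))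
      = mulCoeff V W B (f.toLinearMap.lTensor V x ⊗ₜ f.toLinearMap.lTensor W y) := by
  induction x with
  | zero => simp
  | add x x' hx hx' => simp only [TensorProduct.add_tmul, map_add, hx, hx']
  | tmul v a =>
  induction y with
  | zero => simp
  | add y y' hy hy' => simp only [TensorProduct.tmul_add, map_add, hy, hy']
  | tmul w b => simp

theorem rTensor_mulCoeff (e : V →ₗ[k] V') (e' : W →ₗ[k] W') (x : V ⊗[k] A) (y : W ⊗[k] A) :
    (TensorProduct.map e e').rTensor A (mulCoeff V W A (x ⊗ₜ y))
      = mulCoeff V' W' A (e.rTensor A x ⊗ₜ e'.rTensor A y) := by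
  induction x with
  | zero => simp
  | add x x' hx hx' => simp only [TensorProduct.add_tmul, map_add, hx, hx']
  | tmul v a =>
  induction y with
  | zero => simp
  | add y y' hy hy' => simp only [TensorProduct.tmul_add, map_add, hy, hy']
  | tmul w b => simp

theorem mulCoeff_assoc (x : U ⊗[k] A) (y : V ⊗[k] A) (z : W ⊗[k] A) :
    (TensorProduct.assoc k U V W).toLinearMap.rTensor A
        (mulCoeff (U ⊗[k] V) W A (mulCoeff U V A (x ⊗ₜ y) ⊗ₜ z))
      = mulCoeff U (V ⊗[k] W) A (x ⊗ₜ mulCoeff V W A (y ⊗ₜ z)) := by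
  induction x with
  | zero => simp
  | add x x' hx hx' => simp only [TensorProduct.add_tmul, map_add, hx, hx']
  | tmul u a =>
  induction y with
  | zero => simp
  | add y y' hy hy' => simp only [TensorProduct.tmul_add, TensorProduct.add_tmul, map_add, hy, hy']
  | tmul v b =>
  induction z with
  | zero => simp
  | add z z' hz hz' => simp only [TensorProduct.tmul_add, map_add, hz, hz']
  | tmul w c => simp [mul_assoc]

theorem mulCoeff_tensor (x : V ⊗[k] A) (y : W ⊗[k] A) (a b : A) :
    TensorProduct.assoc k (V ⊗[k] W) A A (mulCoeff V W A (x ⊗ₜ y) ⊗ₜ (a * b))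
      = mulCoeff V W (A ⊗[k] A)
          (TensorProduct.assoc k V A A (x ⊗ₜ a) ⊗ₜ TensorProduct.assoc k W A A (y ⊗ₜ b)) := by
  induction x with
  | zero => simp
  | add x x' hx hx' => simp only [TensorProduct.add_tmul, map_add, hx, hx']
  | tmul v c =>
  induction y with
  | zero => simp
  | add y y' hy hy' => simp only [TensorProduct.tmul_add, TensorProduct.add_tmul, map_add, hy, hy']
  | tmul w d => simp

theorem mulCoeff_coact (f : V →ₗ[k] V ⊗[k] A) (g : W →ₗ[k] W ⊗[k] A)
    (x : V ⊗[k] A) (y : W ⊗[k] A) :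
    TensorProduct.assoc k (V ⊗[k] W) A A
        ((mulCoeff V W A ∘ₗ TensorProduct.map f g).rTensor A (mulCoeff V W A (x ⊗ₜ y)))
      = mulCoeff V W (A ⊗[k] A)
          (TensorProduct.assoc k V A A (f.rTensor A x) ⊗ₜ
            TensorProduct.assoc k W A A (g.rTensor A y)) := by
  induction x with
  | zero => simp
  | add x x' hx hx' => simp only [TensorProduct.add_tmul, map_add, hx, hx']
  | tmul v c =>
  induction y with
  | zero => simp
  | add y y' hy hy' => simp only [TensorProduct.tmul_add, map_add, hy, hy']
  | tmul w d =>
    simp only [mulCoeff_tmul, LinearMap.rTensor_tmul, LinearMap.comp_apply, TensorProduct.map_tmul]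
    exact mulCoeff_tensor _ _ _ _

theorem rid_mulCoeff (x : V ⊗[k] k) (y : W ⊗[k] k) :
    TensorProduct.rid k (V ⊗[k] W) (mulCoeff V W k (x ⊗ₜ y))
      = TensorProduct.rid k V x ⊗ₜ TensorProduct.rid k W y := by
  induction x with
  | zero => simp
  | add x x' hx hx' => simp only [TensorProduct.add_tmul, map_add, hx, hx']
  | tmul v c =>
  induction y with
  | zero => simp
  | add y y' hy hy' => simp only [TensorProduct.tmul_add, map_add, hy, hy']
  | tmul w d => simp [TensorProduct.smul_tmul', smul_smul, mul_comm]

theorem assoc_rTensor_map (f : V →ₗ[k] V') (ρ : V →ₗ[k] V ⊗[k] A) (σ : V' →ₗ[k] V' ⊗[k] A)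
    (h : σ ∘ₗ f = f.rTensor A ∘ₗ ρ) (x : V ⊗[k] A) :
    TensorProduct.assoc k V' A A (σ.rTensor A (f.rTensor A x))
      = f.rTensor (A ⊗[k] A) (TensorProduct.assoc k V A A (ρ.rTensor A x)) := by
  induction x with
  | zero => simp
  | add x x' hx hx' => simp only [map_add, hx, hx']
  | tmul v a =>
  have hv : σ (f v) = f.rTensor A (ρ v) := LinearMap.congr_fun h v
  rw [LinearMap.rTensor_tmul, LinearMap.rTensor_tmul, LinearMap.rTensor_tmul, hv]
  induction ρ v with
  | zero => simp
  | add y y' hy hy' => simp only [TensorProduct.add_tmul, map_add, hy, hy']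
  | tmul w b => simp

theorem lTensor_rTensor_map (f : V →ₗ[k] V') {M N : Type*} [AddCommGroup M] [Module k M]
    [AddCommGroup N] [Module k N] (g : M →ₗ[k] N) (x : V ⊗[k] M) :
    g.lTensor V' (f.rTensor M x) = f.rTensor N (g.lTensor V x) := by
  induction x with
  | zero => simp
  | add x x' hx hx' => simp only [map_add, hx, hx']
  | tmul v a => simp

theorem rid_rTensor_map (f : V →ₗ[k] V') (x : V ⊗[k] k) :
    TensorProduct.rid k V' (f.rTensor k x) = f (TensorProduct.rid k V x) := by
  induction x with
  | zero => simp
  | add x x' hx hx' => simp only [map_add, hx, hx']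
  | tmul v a => simp

theorem lid_mulCoeff (y : W ⊗[k] A) :
    (TensorProduct.lid k W).toLinearMap.rTensor A (mulCoeff k W A ((1 ⊗ₜ 1) ⊗ₜ y)) = y := by
  induction y with
  | zero => simp
  | add y y' hy hy' => simp only [TensorProduct.tmul_add, map_add, hy, hy']
  | tmul w d => simp

theorem rid_mulCoeff' (x : V ⊗[k] A) :
    (TensorProduct.rid k V).toLinearMap.rTensor A (mulCoeff V k A (x ⊗ₜ (1 ⊗ₜ 1))) = x := by
  induction x with
  | zero => simp
  | add x x' hx hx' => simp only [TensorProduct.add_tmul, map_add, hx, hx']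
  | tmul v d => simp

end

variable {H : Type v} [Ring H] [Bialgebra k H]

theorem coassoc_apply (V : FDComod k H) (x : V.carrier) :
    TensorProduct.assoc k V.carrier H H (V.coact.rTensor H (V.coact x))
      = (CoalgebraStruct.comul (R := k) (A := H)).lTensor V.carrier (V.coact x) :=
  LinearMap.congr_fun V.coassoc x

theorem counit_apply (V : FDComod k H) (x : V.carrier) :
    TensorProduct.rid k V.carrier
      ((CoalgebraStruct.counit (R := k) (A := H)).lTensor V.carrier (V.coact x)) = x :=
  LinearMap.congr_fun V.counit x

/-- Two comodules are isomorphic if there is a linear isomorphism that is compatible with the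
structure maps. -/
def Iso (V W : FDComod k H) : Prop :=
  ∃ e : V.carrier ≃ₗ[k] W.carrier,
    W.coact ∘ₗ e.toLinearMap = e.toLinearMap.rTensor H ∘ₗ V.coact

theorem Iso.refl (V : FDComod k H) : Iso V V :=
  ⟨LinearEquiv.refl k V.carrier, by ext x; simp⟩

theorem Iso.symm {V W : FDComod k H} : Iso V W → Iso W V := by
  rintro ⟨e, he⟩
  refine ⟨e.symm, ?_⟩
  ext x
  have h := LinearMap.congr_fun he (e.symm x)
  simp only [LinearMap.comp_apply, LinearEquiv.coe_coe, LinearEquiv.apply_symm_apply] at h ⊢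
  rw [h, ← LinearMap.comp_apply, ← LinearMap.rTensor_comp]
  simp

theorem Iso.trans {U V W : FDComod k H} : Iso U V → Iso V W → Iso U W := by
  rintro ⟨e, he⟩ ⟨f, hf⟩
  refine ⟨e.trans f, ?_⟩
  ext x
  have h := LinearMap.congr_fun he x
  have h' := LinearMap.congr_fun hf (e x)
  simp only [LinearMap.comp_apply, LinearEquiv.coe_coe, LinearEquiv.trans_apply] at h h' ⊢
  rw [h', h, LinearEquiv.coe_trans, LinearMap.rTensor_comp]
  rfl

/-- The neutral object: the trivial comodule `k` with structure map `c ↦ c ⊗ 1`. -/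
def unit (k : Type u) [Field k] (H : Type v) [Ring H] [Bialgebra k H] : FDComod k H where
  carrier := k
  coact := (TensorProduct.mk k k H).flip 1
  coassoc := by
    ext
    simp [Algebra.TensorProduct.one_def]
  counit := by
    ext
    simp

/-- The tensor product of comodules, with structure map
`v ⊗ w ↦ v₀ ⊗ w₀ ⊗ v₁ w₁` in Sweedler notation. -/
def tensor (V W : FDComod k H) : FDComod k H where
  carrier := V.carrier ⊗[k] W.carrier
  coact := mulCoeff V.carrier W.carrier H ∘ₗ TensorProduct.map V.coact W.coact
  coassoc := by
    ext v w
    have h := lTensor_mulCoeff (Bialgebra.comulAlgHom k H) (V.coact v) (W.coact w)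
    have h' : (Bialgebra.comulAlgHom k H).toLinearMap = CoalgebraStruct.comul := rfl
    rw [h'] at h
    simp only [TensorProduct.AlgebraTensorModule.curry_apply, TensorProduct.curry_apply,
      LinearMap.coe_restrictScalars, LinearMap.comp_apply, TensorProduct.map_tmul,
      LinearEquiv.coe_coe]
    rw [h, mulCoeff_coact, coassoc_apply, coassoc_apply]
  counit := by
    ext v w
    have h := lTensor_mulCoeff (Bialgebra.counitAlgHom k H) (V.coact v) (W.coact w)
    have h' : (Bialgebra.counitAlgHom k H).toLinearMap = CoalgebraStruct.counit := rfl
    rw [h'] at h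
    simp only [TensorProduct.AlgebraTensorModule.curry_apply, TensorProduct.curry_apply,
      LinearMap.coe_restrictScalars, LinearMap.comp_apply, TensorProduct.map_tmul,
      LinearEquiv.coe_coe, LinearMap.id_apply]
    rw [h, rid_mulCoeff, counit_apply, counit_apply]

/-- The direct sum of comodules. -/
def directSum (V W : FDComod k H) : FDComod k H where
  carrier := V.carrier × W.carrier
  coact := LinearMap.coprod
    ((LinearMap.inl k V.carrier W.carrier).rTensor H ∘ₗ V.coact)
    ((LinearMap.inr k V.carrier W.carrier).rTensor H ∘ₗ W.coact)
  coassoc := by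
    ext x
    · have h := assoc_rTensor_map (LinearMap.inl k V.carrier W.carrier) V.coact
        (LinearMap.coprod
          ((LinearMap.inl k V.carrier W.carrier).rTensor H ∘ₗ V.coact)
          ((LinearMap.inr k V.carrier W.carrier).rTensor H ∘ₗ W.coact))
        (LinearMap.coprod_inl _ _) (V.coact x)
      simp only [LinearMap.comp_apply, LinearEquiv.coe_coe, LinearMap.inl_apply,
        LinearMap.coprod_apply, map_zero, add_zero] at h ⊢
      rw [h, coassoc_apply, lTensor_rTensor_map]
    · have h := assoc_rTensor_map (LinearMap.inr k V.carrier W.carrier) W.coact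
        (LinearMap.coprod
          ((LinearMap.inl k V.carrier W.carrier).rTensor H ∘ₗ V.coact)
          ((LinearMap.inr k V.carrier W.carrier).rTensor H ∘ₗ W.coact))
        (LinearMap.coprod_inr _ _) (W.coact x)
      simp only [LinearMap.comp_apply, LinearEquiv.coe_coe, LinearMap.inr_apply,
        LinearMap.coprod_apply, map_zero, zero_add] at h ⊢
      rw [h, coassoc_apply, lTensor_rTensor_map]
  counit := by
    refine LinearMap.prod_ext (LinearMap.ext fun x => ?_) (LinearMap.ext fun x => ?_)
    · simp only [LinearMap.comp_apply, LinearEquiv.coe_coe, LinearMap.inl_apply,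
        LinearMap.coprod_apply, map_zero, add_zero, LinearMap.id_apply]
      rw [lTensor_rTensor_map, rid_rTensor_map, counit_apply, LinearMap.inl_apply]
    · simp only [LinearMap.comp_apply, LinearEquiv.coe_coe, LinearMap.inr_apply,
        LinearMap.coprod_apply, map_zero, zero_add, LinearMap.id_apply]
      rw [lTensor_rTensor_map, rid_rTensor_map, counit_apply, LinearMap.inr_apply]

theorem Iso.tensor {V V' W W' : FDComod k H} (h : Iso V V') (h' : Iso W W') :
    Iso (V.tensor W) (V'.tensor W') := by
  obtain ⟨e, he⟩ := h
  obtain ⟨f, hf⟩ := h'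
  refine ⟨TensorProduct.congr e f, ?_⟩
  refine TensorProduct.ext' fun v w => ?_
  have h1 := LinearMap.congr_fun he v
  have h2 := LinearMap.congr_fun hf w
  have h3 := rTensor_mulCoeff (A := H) e.toLinearMap f.toLinearMap (V.coact v) (W.coact w)
  simp only [LinearMap.comp_apply, LinearEquiv.coe_coe] at h1 h2
  rw [← h1, ← h2] at h3
  exact h3.symm

theorem tensor_assoc (U V W : FDComod k H) :
    Iso ((U.tensor V).tensor W) (U.tensor (V.tensor W)) := by
  refine ⟨TensorProduct.assoc k U.carrier V.carrier W.carrier, ?_⟩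
  refine TensorProduct.ext_threefold fun u v w => ?_
  exact (mulCoeff_assoc (A := H) (U.coact u) (V.coact v) (W.coact w)).symm

theorem unit_tensor (V : FDComod k H) : Iso ((unit k H).tensor V) V := by
  refine ⟨TensorProduct.lid k V.carrier, ?_⟩
  refine TensorProduct.ext' fun (c : k) v => ?_
  have h := lid_mulCoeff (A := H) (c • V.coact v)
  have h' : (TensorProduct.mk k k H).flip 1 c = c • ((1 : k) ⊗ₜ[k] (1 : H)) := by
    simp [TensorProduct.smul_tmul']
  refine Eq.trans ?_ (h.symm.trans ?_)
  · exact map_smul V.coact c v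
  · change _ = (TensorProduct.lid k V.carrier).toLinearMap.rTensor H
      (mulCoeff k V.carrier H ((TensorProduct.mk k k H).flip 1 c ⊗ₜ V.coact v))
    rw [h', TensorProduct.smul_tmul]

theorem tensor_unit (V : FDComod k H) : Iso (V.tensor (unit k H)) V := by
  refine ⟨TensorProduct.rid k V.carrier, ?_⟩
  refine TensorProduct.ext' fun v (c : k) => ?_
  have h := rid_mulCoeff' (A := H) (c • V.coact v)
  have h' : (TensorProduct.mk k k H).flip 1 c = c • ((1 : k) ⊗ₜ[k] (1 : H)) := by
    simp [TensorProduct.smul_tmul']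
  refine Eq.trans ?_ (h.symm.trans ?_)
  · exact map_smul V.coact c v
  · change _ = (TensorProduct.rid k V.carrier).toLinearMap.rTensor H
      (mulCoeff V.carrier k H (V.coact v ⊗ₜ (TensorProduct.mk k k H).flip 1 c))
    rw [h', TensorProduct.smul_tmul]

/-- Isomorphism of comodules as an equivalence relation. -/
def isoSetoid (k : Type u) [Field k] (H : Type v) [Ring H] [Bialgebra k H] :
    Setoid (FDComod k H) where
  r := Iso
  iseqv := ⟨Iso.refl, Iso.symm, Iso.trans⟩

end

end FDComod

/-- The set of isomorphism classes of finite dimensional right `H`-comodules. -/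
def ComodClass (k : Type u) [Field k] (H : Type v) [Ring H] [Bialgebra k H] : Type (max (u + 1) v) :=
  Quotient (FDComod.isoSetoid k H)

namespace ComodClass

section

variable {k : Type u} [Field k] {H : Type v} [Ring H] [Bialgebra k H]

/-- The isomorphism class of a comodule. -/
def mk (V : FDComod k H) : ComodClass k H := Quotient.mk (FDComod.isoSetoid k H) V

/-- Isomorphism classes of comodules form a monoid under the tensor product. -/
instance : Monoid (ComodClass k H) where
  mul := Quotient.map₂ FDComod.tensor fun _ _ h _ _ h' => FDComod.Iso.tensor h h'
  one := mk (FDComod.unit k H)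
  mul_assoc := by
    rintro ⟨U⟩ ⟨V⟩ ⟨W⟩
    exact Quotient.sound (FDComod.tensor_assoc U V W)
  one_mul := by
    rintro ⟨V⟩
    exact Quotient.sound (FDComod.unit_tensor V)
  mul_one := by
    rintro ⟨V⟩
    exact Quotient.sound (FDComod.tensor_unit V)

end

end ComodClass

/-- The relations `[V ⊕ W] = [V] + [W]` of the Green ring, one for each split short exact sequence
of comodules. -/
inductive GreenRel (k : Type u) [Field k] (H : Type v) [Ring H] [Bialgebra k H] :
    MonoidAlgebra ℤ (ComodClass k H) → MonoidAlgebra ℤ (ComodClass k H) → Prop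
  | directSum (V W : FDComod k H) : GreenRel k H
      (MonoidAlgebra.of ℤ _ (ComodClass.mk (V.directSum W)))
      (MonoidAlgebra.of ℤ _ (ComodClass.mk V) + MonoidAlgebra.of ℤ _ (ComodClass.mk W))

/-- The Green ring of the tensor category of finite dimensional right `H`-comodules: the free
abelian group on the isomorphism classes, with the multiplication `[V] [W] = [V ⊗ W]`, modulo
the relations given by split short exact sequences. -/
def GreenRing (k : Type u) [Field k] (H : Type v) [Ring H] [Bialgebra k H] : Type (max (u + 1) v) :=
  RingQuot (GreenRel k H)

instance (k : Type u) [Field k] (H : Type v) [Ring H] [Bialgebra k H] : Ring (GreenRing k H) :=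
  inferInstanceAs (Ring (RingQuot (GreenRel k H)))

end

/-! Expanding the structure map of a comodule in the basis of paths gives operators `op i l`.
Coassociativity says that they compose as the paths do, and the counit axiom says that the vertices
give a decomposition of the identity. A finite dimensional comodule is thus a finite dimensional
representation of the linear quiver, and it splits into intervals M(i, l), one-dimensional in the
degrees i, …, i + l (`exists_iso_interval_directSum`, `cls_mem_lower`). The rank of `op i l` is
additive on direct sums, so it extends to an additive function on the Green ring
(`exists_opRank_hom`).

Put x = [M(1, 0)], y = [M(0, 1)], z = [M(0, d)]. Tensoring with M(i, 0) shifts degrees by i.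
Explicit generating vectors give the Clebsch–Gordan rule y [M(0, n + 1)] = [M(0, n + 2)] + x [M(0,
n)] as long as the q-integer of n + 2 is nonzero (`intervalCls_one_mul`). Hence for l < d the class
of M(0, l) is the Chebyshev-type polynomial F_l(x, y), whose closed form is the sum in the theorem.
As the q-integer of d vanishes, y [M(0, d - 1)] = (1 + x) [M(0, d - 1)] instead
(`intervalCls_one_mul_of_qInt_eq_zero`), and this is the defining relation (`chebyshev_relation`).

There is no further relation because the monomials x^i z^b y^a with a < d are unitriangular with
respect to the intervals: the product has leading summand M(i, bd + a), multiplicity one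
(`IsDominated.tensor`). The leading summand survives a tensor product exactly because a Gaussian
binomial is nonzero. The ones that occur are binom(bd + d, bd)_q = b + 1, nonzero in characteristic
0, and the q-integer of bd + a + 1 with a + 1 < d. It follows that x, its inverse, y, z generate
(`subring_eq_top`), that they commute (`green_mul_comm`), and that the monomials are linearly
independent (`linearIndependent_monomialCls`).

In the abstract quotient the relation is monic of degree d in y, so the same monomials span it
(`span_reducedMonomial_eq_top`). The surjection onto the Green ring sends a spanning family to an
independent one and is therefore an isomorphism (`nonempty_ringEquiv_quotient`). -/

noncomputable section

/-! ### Coefficients of tensors along the basis of paths -/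

namespace LinearQuiverHopf

variable {k : Type*} [Field k] {q : kˣ}

/-- The coefficient of the path of length `l` with source `g ^ i`. -/
def coeff (i : ℤ) (l : ℕ) : LinearQuiverHopf k q →ₗ[k] k :=
  lift fun j m => if j = i ∧ m = l then 1 else 0

variable {V W : Type*} [AddCommGroup V] [Module k V] [AddCommGroup W] [Module k W]

/-- The coefficient of an element of `V ⊗ H` at the path of length `l` with source `g ^ i`. -/
def pathCoeff (i : ℤ) (l : ℕ) : V ⊗[k] LinearQuiverHopf k q →ₗ[k] V :=
  (TensorProduct.rid k V).toLinearMap ∘ₗ (coeff i l).lTensor V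

@[simp] theorem pathCoeff_tmul_path (i j : ℤ) (l m : ℕ) (v : V) :
    pathCoeff i l (v ⊗ₜ[k] path q j m) = if j = i ∧ m = l then v else 0 := by
  simp [pathCoeff, coeff]

theorem pathCoeff_rTensor (f : V →ₗ[k] W) (i : ℤ) (l : ℕ) (t : V ⊗[k] LinearQuiverHopf k q) :
    pathCoeff i l (f.rTensor _ t) = f (pathCoeff i l t) := by
  induction t with
  | zero => simp
  | add x y hx hy => simp only [map_add, hx, hy]
  | tmul v a => simp [pathCoeff]

theorem tensor_induction {P : V ⊗[k] LinearQuiverHopf k q → Prop}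
    (t : V ⊗[k] LinearQuiverHopf k q) (tmul : ∀ v i l, P (v ⊗ₜ path q i l))
    (add : ∀ x y, P x → P y → P (x + y)) : P t := by
  induction t with
  | zero =>
    have := tmul 0 0 0
    rwa [TensorProduct.zero_tmul] at this
  | add x y hx hy => exact add x y hx hy
  | tmul v a =>
    induction a using path_induction generalizing v with
    | path i l => exact tmul v i l
    | add x y hx hy => rw [TensorProduct.tmul_add]; exact add _ _ (hx v) (hy v)
    | smul c x hx => rw [← TensorProduct.smul_tmul]; exact hx _

/-- The expansion is asserted for every larger index set, so that several tensors can be expanded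
over a common one. -/
theorem exists_eq_sum_pathCoeff (t : V ⊗[k] LinearQuiverHopf k q) :
    ∃ T : Finset (ℤ × ℕ), ∀ T', T ⊆ T' →
      t = ∑ p ∈ T', pathCoeff p.1 p.2 t ⊗ₜ[k] path q p.1 p.2 := by
  classical
  induction t using tensor_induction with
  | tmul v i l =>
    refine ⟨{(i, l)}, fun T' h => ?_⟩
    rw [Finset.sum_eq_single_of_mem (i, l) (by simpa using h)]
    · simp
    · rintro ⟨j, m⟩ _ hne
      rw [pathCoeff_tmul_path, if_neg, TensorProduct.zero_tmul]
      rintro ⟨rfl, rfl⟩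
      exact hne rfl
  | add x y hx hy =>
    obtain ⟨T, hT⟩ := hx
    obtain ⟨S, hS⟩ := hy
    refine ⟨T ∪ S, fun T' h => ?_⟩
    simp only [map_add, TensorProduct.add_tmul, Finset.sum_add_distrib]
    rw [← hT T' (Finset.union_subset_left h), ← hS T' (Finset.union_subset_right h)]

theorem pathCoeff_ext {t t' : V ⊗[k] LinearQuiverHopf k q}
    (h : ∀ i l, pathCoeff i l t = pathCoeff i l t') : t = t' := by
  classical
  obtain ⟨T, hT⟩ := exists_eq_sum_pathCoeff t
  obtain ⟨S, hS⟩ := exists_eq_sum_pathCoeff t'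
  rw [hT (T ∪ S) Finset.subset_union_left, hS (T ∪ S) Finset.subset_union_right]
  simp only [h]

/-- The last tensor factor of a comultiplied path is its initial part. Extracting that part and then
the rest recovers the concatenated path, which exists only if the second path starts where the first
one ends. -/
theorem pathCoeff_pathCoeff_comul (i j : ℤ) (l m : ℕ) (t : V ⊗[k] LinearQuiverHopf k q) :
    pathCoeff j m (pathCoeff i l ((TensorProduct.assoc k V _ _).symm
      ((CoalgebraStruct.comul (R := k) (A := LinearQuiverHopf k q)).lTensor V t)))
      = if j = i + l then pathCoeff i (l + m) t else 0 := by
  induction t using tensor_induction with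
  | add x y hx hy =>
    simp only [map_add, hx, hy]
    split_ifs <;> simp
  | tmul v n s =>
    simp only [LinearMap.lTensor_tmul, comul_path, TensorProduct.tmul_sum, map_sum,
      TensorProduct.assoc_symm_tmul, pathCoeff_tmul_path]
    rw [Finset.sum_congr rfl (g := fun x : ℕ × ℕ =>
      if x = (m, l) then (if j = i + l ∧ n = i then v else 0) else 0)]
    · rw [Finset.sum_ite_eq']
      simp only [Finset.HasAntidiagonal.mem_antidiagonal]
      split_ifs <;> first | rfl | (exfalso; grind)
    · rintro ⟨a, b⟩ _
      simp only [Prod.mk.injEq]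
      split_ifs <;> simp <;> grind

end LinearQuiverHopf

/-! ### Comodules as representations of the quiver -/

namespace FDComod

open LinearQuiverHopf

section

variable {k : Type u} [Field k] {q : kˣ} (V W : FDComod k (LinearQuiverHopf k q))

/-- The action on a comodule of the path of length `l` with source `g ^ i`: the coefficient of
that path in the structure map. -/
def op (i : ℤ) (l : ℕ) : V.carrier →ₗ[k] V.carrier := pathCoeff i l ∘ₗ V.coact

theorem op_apply (i : ℤ) (l : ℕ) (v : V.carrier) : V.op i l v = pathCoeff i l (V.coact v) := rfl

/-- Coassociativity read off on coefficients; with `sum_op_zero`, which is the counit axiom, it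
identifies comodules with quiver representations. -/
theorem op_op (i j : ℤ) (l m : ℕ) (v : V.carrier) :
    V.op j m (V.op i l v) = if j = i + l then V.op i (l + m) v else 0 := by
  have h := pathCoeff_pathCoeff_comul i j l m (V.coact v)
  rw [← coassoc_apply, LinearEquiv.symm_apply_apply, pathCoeff_rTensor] at h
  exact h

theorem op_op_of_eq {i j : ℤ} {l : ℕ} (h : j = i + l) (m : ℕ) (v : V.carrier) :
    V.op j m (V.op i l v) = V.op i (l + m) v := by rw [op_op, if_pos h]

theorem op_op_of_ne {i j : ℤ} {l : ℕ} (h : j ≠ i + l) (m : ℕ) (v : V.carrier) :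
    V.op j m (V.op i l v) = 0 := by rw [op_op, if_neg h]

theorem exists_coact_eq_sum : ∃ T : Finset (ℤ × ℕ), ∀ T', T ⊆ T' → ∀ v,
    V.coact v = ∑ p ∈ T', V.op p.1 p.2 v ⊗ₜ[k] path q p.1 p.2 := by
  classical
  let b := Module.finBasis k V.carrier
  choose T hT using fun s => exists_eq_sum_pathCoeff (V.coact (b s))
  refine ⟨Finset.univ.biUnion T, fun T' h v => ?_⟩
  have : V.coact = ∑ p ∈ T', (TensorProduct.mk k V.carrier (LinearQuiverHopf k q)).flip
      (path q p.1 p.2) ∘ₗ V.op p.1 p.2 := by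
    refine b.ext fun s => ?_
    rw [hT s T' ((Finset.subset_biUnion_of_mem T (Finset.mem_univ s)).trans h)]
    simp [LinearMap.sum_apply, op_apply]
  have h2 := LinearMap.congr_fun this v
  simpa [LinearMap.sum_apply] using h2

/-- A finite set of paths that contains all those that act in a nonzero way. -/
def opSupport : Finset (ℤ × ℕ) := V.exists_coact_eq_sum.choose

theorem coact_eq_sum {T : Finset (ℤ × ℕ)} (h : V.opSupport ⊆ T) (v : V.carrier) :
    V.coact v = ∑ p ∈ T, V.op p.1 p.2 v ⊗ₜ[k] path q p.1 p.2 :=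
  V.exists_coact_eq_sum.choose_spec T h v

theorem op_eq_zero {p : ℤ × ℕ} (h : p ∉ V.opSupport) : V.op p.1 p.2 = 0 := by
  ext v
  rw [op_apply, V.coact_eq_sum subset_rfl, map_sum, Finset.sum_eq_zero, LinearMap.zero_apply]
  rintro ⟨i, l⟩ hp
  rw [pathCoeff_tmul_path, if_neg]
  rintro ⟨h1, h2⟩
  apply h
  rwa [← Prod.mk.eta (p := p), ← h1, ← h2]

theorem sum_op_zero (v : V.carrier) :
    ∑ p ∈ V.opSupport, (if p.2 = 0 then V.op p.1 p.2 v else 0) = v := by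
  have h := V.counit_apply v
  rw [V.coact_eq_sum subset_rfl] at h
  simpa [counit_path] using h

variable {V W}

theorem Iso.of_op (e : V.carrier ≃ₗ[k] W.carrier)
    (h : ∀ i l v, e (V.op i l v) = W.op i l (e v)) : Iso V W := by
  refine ⟨e, LinearMap.ext fun v => pathCoeff_ext fun i l => ?_⟩
  simp only [LinearMap.comp_apply, LinearEquiv.coe_coe, pathCoeff_rTensor]
  exact (h i l v).symm

theorem op_conj (e : V.carrier ≃ₗ[k] W.carrier)
    (he : W.coact ∘ₗ e.toLinearMap = e.toLinearMap.rTensor _ ∘ₗ V.coact) (i : ℤ) (l : ℕ)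
    (v : V.carrier) : e (V.op i l v) = W.op i l (e v) := by
  have h := congrArg (pathCoeff i l) (LinearMap.congr_fun he v)
  simp only [LinearMap.comp_apply, LinearEquiv.coe_coe, pathCoeff_rTensor] at h
  exact h.symm

/-- The structure map `v ↦ ∑ F p v ⊗ p`, the sum being over the paths `p` in `T`. -/
def coactOfOps {V : Type*} [AddCommGroup V] [Module k V] (q : kˣ) (F : ℤ → ℕ → V →ₗ[k] V)
    (T : Finset (ℤ × ℕ)) : V →ₗ[k] V ⊗[k] LinearQuiverHopf k q :=
  ∑ p ∈ T, (TensorProduct.mk k V (LinearQuiverHopf k q)).flip (path q p.1 p.2) ∘ₗ F p.1 p.2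

theorem coactOfOps_apply {V : Type*} [AddCommGroup V] [Module k V] (F : ℤ → ℕ → V →ₗ[k] V)
    (T : Finset (ℤ × ℕ)) (v : V) :
    coactOfOps q F T v = ∑ p ∈ T, F p.1 p.2 v ⊗ₜ[k] path q p.1 p.2 := by
  simp [coactOfOps, LinearMap.sum_apply]

theorem pathCoeff_coactOfOps {V : Type*} [AddCommGroup V] [Module k V] {F : ℤ → ℕ → V →ₗ[k] V}
    {T : Finset (ℤ × ℕ)} (hT : ∀ p ∉ T, F p.1 p.2 = 0) (i : ℤ) (l : ℕ) (v : V) :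
    pathCoeff i l (coactOfOps q F T v) = F i l v := by
  rw [coactOfOps_apply]
  simp only [map_sum, pathCoeff_tmul_path]
  by_cases h : (i, l) ∈ T
  · rw [Finset.sum_eq_single_of_mem (i, l) h]
    · simp
    · rintro ⟨j, m⟩ _ hne
      exact if_neg fun h => hne (Prod.ext h.1 h.2)
  · rw [show F i l v = 0 from LinearMap.congr_fun (hT _ h) v]
    refine Finset.sum_eq_zero ?_
    rintro ⟨j, m⟩ hjm
    refine if_neg ?_
    rintro ⟨rfl, rfl⟩
    exact h hjm

/-- The comodule with prescribed actions of the paths. -/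
def ofOps (V : Type u) [AddCommGroup V] [Module k V] [FiniteDimensional k V] (q : kˣ)
    (F : ℤ → ℕ → V →ₗ[k] V) (T : Finset (ℤ × ℕ)) (hT : ∀ p ∉ T, F p.1 p.2 = 0)
    (hF : ∀ i j l m v, F j m (F i l v) = if j = i + (l : ℤ) then F i (l + m) v else 0)
    (h1 : ∀ v, ∑ p ∈ T, (if p.2 = 0 then F p.1 p.2 v else 0) = v) :
    FDComod k (LinearQuiverHopf k q) where
  carrier := V
  coact := coactOfOps q F T
  coassoc := by
    refine LinearMap.ext fun v => ?_
    rw [LinearMap.comp_apply, LinearMap.comp_apply, LinearMap.comp_apply, LinearEquiv.coe_coe,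
      ← LinearEquiv.eq_symm_apply]
    refine pathCoeff_ext fun i l => pathCoeff_ext fun j m => ?_
    rw [pathCoeff_pathCoeff_comul, pathCoeff_rTensor, pathCoeff_coactOfOps hT,
      pathCoeff_coactOfOps hT, pathCoeff_coactOfOps hT, hF]
  counit := by
    refine LinearMap.ext fun v => ?_
    have h := h1 v
    simpa [coactOfOps_apply, counit_path] using h

theorem ofOps_op (V : Type u) [AddCommGroup V] [Module k V] [FiniteDimensional k V]
    (F : ℤ → ℕ → V →ₗ[k] V) (T : Finset (ℤ × ℕ)) (hT hF h1) (i : ℤ) (l : ℕ) :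
    (ofOps V q F T hT hF h1).op i l = F i l :=
  LinearMap.ext fun v => pathCoeff_coactOfOps (q := q) hT i l v

end

end FDComod

/-! ### Interval comodules, tensor products of homogeneous vectors, and splitting off an interval -/

namespace FDComod

open LinearQuiverHopf

section

variable {k : Type u} [Field k] {q : kˣ}

/-- The action of the path of length `b` with source `g ^ j` on the comodule `interval i l`. -/
def intervalOp (k : Type*) [Field k] (i : ℤ) (l : ℕ) (j : ℤ) (b : ℕ) :
    (Fin (l + 1) → k) →ₗ[k] (Fin (l + 1) → k) where
  toFun f a := if i + (a : ℕ) = j + b ∧ b ≤ a then f ⟨a - b, by omega⟩ else 0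
  map_add' f g := by
    ext a
    simp only [Pi.add_apply]
    split_ifs <;> simp
  map_smul' c f := by
    ext a
    simp only [Pi.smul_apply, RingHom.id_apply]
    split_ifs <;> simp

theorem intervalOp_apply (i : ℤ) (l : ℕ) (j : ℤ) (b : ℕ) (f : Fin (l + 1) → k)
    (a : Fin (l + 1)) : intervalOp k i l j b f a
      = if i + (a : ℕ) = j + b ∧ b ≤ a then f ⟨a - b, by omega⟩ else 0 := rfl

/-- The indecomposable comodule with one-dimensional components in degrees `i, …, i + l`. -/
def interval (q : kˣ) (i : ℤ) (l : ℕ) : FDComod k (LinearQuiverHopf k q) :=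
  ofOps (Fin (l + 1) → k) q (intervalOp k i l)
    ((Finset.range (l + 1) ×ˢ Finset.range (l + 1)).image fun p => (i + p.1, p.2))
    (by
      rintro ⟨j, b⟩ h
      ext f a
      simp only [LinearMap.comp_apply, intervalOp_apply, LinearMap.zero_apply, Pi.zero_apply]
      refine if_neg ?_
      rintro ⟨h1, h2⟩
      refine h (Finset.mem_image.2 ⟨(a - b, b), ?_, ?_⟩)
      · simp only [Finset.mem_product, Finset.mem_range]
        omega
      · simp only [Prod.mk.injEq, and_true]
        omega)
    (by
      intro j j' b b' f
      by_cases h : j' = j + b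
      · rw [if_pos h]
        ext a
        simp only [intervalOp_apply]
        subst h
        by_cases h1 : i + (a : ℕ) = j + b + b' ∧ b' ≤ a
        · rw [if_pos h1]
          by_cases h2 : b ≤ a - b'
          · rw [if_pos ⟨by omega, h2⟩, if_pos ⟨by push_cast; omega, by omega⟩]
            congr 2
            omega
          · rw [if_neg (by omega), if_neg (by omega)]
        · rw [if_neg h1, if_neg]
          rintro ⟨h2, h3⟩
          push_cast at h2
          exact h1 ⟨by omega, by omega⟩
      · rw [if_neg h]
        ext a
        simp only [intervalOp_apply, Pi.zero_apply]
        split_ifs <;> first | rfl | omega)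
    (by
      intro f
      ext a
      rw [Finset.sum_apply, Finset.sum_eq_single_of_mem (i + (a : ℕ), 0)]
      · simp [intervalOp_apply]
      · exact Finset.mem_image.2 ⟨(a, 0), by simp; omega, rfl⟩
      · rintro ⟨j, b⟩ _ hne
        split_ifs with h
        · change b = 0 at h
          subst h
          rw [intervalOp_apply, if_neg]
          rintro ⟨h1, -⟩
          exact hne (by simp at h1 ⊢; omega)
        · rfl)

theorem interval_op (i : ℤ) (l : ℕ) (j : ℤ) (b : ℕ) :
    (interval q i l).op j b = intervalOp k i l j b :=
  ofOps_op (Fin (l + 1) → k) _ _ _ _ _ j b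

theorem finrank_interval (i : ℤ) (l : ℕ) :
    Module.finrank k (interval q i l).carrier = l + 1 :=
  (Module.finrank_fin_fun k : Module.finrank k (Fin (l + 1) → k) = l + 1)

/-- A linear retract of a comodule is a comodule if the idempotent is an endomorphism. -/
def retract (V : FDComod k (LinearQuiverHopf k q)) (W : Type u) [AddCommGroup W] [Module k W]
    [FiniteDimensional k W] (a : W →ₗ[k] V.carrier) (b : V.carrier →ₗ[k] W)
    (hba : ∀ w, b (a w) = w) (hab : ∀ i l v, a (b (V.op i l v)) = V.op i l (a (b v))) :
    FDComod k (LinearQuiverHopf k q) :=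
  ofOps W q (fun i l => b ∘ₗ V.op i l ∘ₗ a) V.opSupport
    (by
      intro p hp
      ext w
      simp [V.op_eq_zero hp])
    (by
      intro i j l m w
      simp only [LinearMap.comp_apply]
      rw [← hab, hba, op_op]
      split_ifs <;> simp)
    (by
      intro w
      have h := congrArg b (V.sum_op_zero (a w))
      rw [map_sum, hba] at h
      refine Eq.trans (Finset.sum_congr rfl fun p _ => ?_) h
      split_ifs <;> simp)

theorem retract_op (V : FDComod k (LinearQuiverHopf k q)) (W : Type u) [AddCommGroup W]
    [Module k W] [FiniteDimensional k W] (a : W →ₗ[k] V.carrier) (b : V.carrier →ₗ[k] W)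
    (hba hab) (i : ℤ) (l : ℕ) (w : W) :
    (V.retract W a b hba hab).op i l w = b (V.op i l (a w)) :=
  LinearMap.congr_fun (ofOps_op W _ _ _ _ _ i l) w

theorem directSum_op (V W : FDComod k (LinearQuiverHopf k q)) (i : ℤ) (l : ℕ)
    (x : V.carrier × W.carrier) :
    (V.directSum W).op i l x = (V.op i l x.1, W.op i l x.2) := by
  have h : (V.directSum W).op i l x
      = pathCoeff i l ((LinearMap.inl k V.carrier W.carrier).rTensor _ (V.coact x.1)
        + (LinearMap.inr k V.carrier W.carrier).rTensor _ (W.coact x.2)) := rfl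
  rw [h, map_add, pathCoeff_rTensor, pathCoeff_rTensor, ← op_apply, ← op_apply]
  exact Prod.ext (add_zero _) (zero_add _)

/-- The action of a path on a tensor product. -/
def tensorOp (V W : FDComod k (LinearQuiverHopf k q)) (i : ℤ) (l : ℕ) :
    V.carrier ⊗[k] W.carrier →ₗ[k] V.carrier ⊗[k] W.carrier := (V.tensor W).op i l

theorem tensorOp_tmul (V W : FDComod k (LinearQuiverHopf k q)) (i : ℤ) (l : ℕ)
    (v : V.carrier) (w : W.carrier) {S T : Finset (ℤ × ℕ)} (hS : V.opSupport ⊆ S)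
    (hT : W.opSupport ⊆ T) :
    V.tensorOp W i l (v ⊗ₜ[k] w)
      = ∑ p ∈ S, ∑ r ∈ T, if p.1 + r.1 = i ∧ p.2 + r.2 = l then
        ((q : k) ^ (p.1 * r.2) * gaussBinom (q : k) (p.2 + r.2) p.2) •
          (V.op p.1 p.2 v ⊗ₜ[k] W.op r.1 r.2 w) else 0 := by
  have h : V.tensorOp W i l (v ⊗ₜ[k] w)
      = pathCoeff i l (mulCoeff V.carrier W.carrier (LinearQuiverHopf k q)
        (V.coact v ⊗ₜ W.coact w)) := rfl
  rw [h, V.coact_eq_sum hS, W.coact_eq_sum hT, TensorProduct.sum_tmul]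
  simp only [TensorProduct.tmul_sum, map_sum, mulCoeff_tmul, path_mul_path,
    TensorProduct.tmul_smul, map_smul, pathCoeff_tmul_path, smul_ite, smul_zero]

/-- A vector is homogeneous of degree `i` if it is fixed by the vertex `g ^ i`. -/
def IsHomog (V : FDComod k (LinearQuiverHopf k q)) (i : ℤ) (v : V.carrier) : Prop :=
  V.op i 0 v = v

theorem IsHomog.op_eq_zero {V : FDComod k (LinearQuiverHopf k q)} {i j : ℤ} {v : V.carrier}
    (hv : V.IsHomog i v) (h : j ≠ i) (l : ℕ) : V.op j l v = 0 := by
  rw [← hv]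
  exact V.op_op_of_ne (by simpa using h) l v

/-- On a homogeneous vector only the paths that start in its degree act, so the double sum reduces
to the ways of splitting the length. -/
theorem tensorOp_of_isHomog {V W : FDComod k (LinearQuiverHopf k q)} {i j : ℤ}
    {v : V.carrier} {w : W.carrier} (hv : V.IsHomog i v) (hw : W.IsHomog j w) (l : ℕ) :
    V.tensorOp W (i + j) l (v ⊗ₜ[k] w)
      = ∑ x ∈ Finset.HasAntidiagonal.antidiagonal l,
        ((q : k) ^ (i * x.2) * gaussBinom (q : k) l x.1) •
          (V.op i x.1 v ⊗ₜ[k] W.op j x.2 w) := by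
  classical
  set A := Finset.HasAntidiagonal.antidiagonal l with hA
  -- The supports are enlarged so that every splitting of `l` occurs in the double sum, even where
  -- it acts by zero.
  rw [tensorOp_tmul V W _ _ v w (S := V.opSupport ∪ A.image fun x => (i, x.1))
    (T := W.opSupport ∪ A.image fun x => (j, x.2)) Finset.subset_union_left
    Finset.subset_union_left, ← Finset.sum_product']
  symm
  refine Finset.sum_of_injOn (fun x => ((i, x.1), (j, x.2))) ?_ ?_ ?_ ?_
  · rintro ⟨a, b⟩ _ ⟨c, d⟩ _ h
    simpa using h
  · rintro ⟨a, b⟩ h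
    simp only [Finset.coe_product, Set.mem_prod, Finset.mem_coe, Finset.mem_union,
      Finset.mem_image]
    exact ⟨Or.inr ⟨(a, b), h, rfl⟩, Or.inr ⟨(a, b), h, rfl⟩⟩
  · rintro ⟨⟨i', a⟩, ⟨j', b⟩⟩ _ h
    rw [ite_eq_right_iff]
    rintro ⟨h1, h2⟩
    dsimp only at h1 h2 ⊢
    by_cases hi : i' = i
    · have hj : j' = j := by omega
      subst hi hj
      refine absurd ?_ h
      exact ⟨(a, b), by simpa [hA] using h2, rfl⟩
    · rw [hv.op_eq_zero hi, TensorProduct.zero_tmul, smul_zero]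
  · rintro ⟨a, b⟩ h
    rw [hA, Finset.HasAntidiagonal.mem_antidiagonal] at h
    dsimp only at h ⊢
    rw [if_pos ⟨rfl, h⟩, h]

/-- The morphism from `interval i l` that is determined by a vector. -/
def intervalHom (V : FDComod k (LinearQuiverHopf k q)) (i : ℤ) (l : ℕ) (u : V.carrier) :
    (Fin (l + 1) → k) →ₗ[k] V.carrier :=
  Fintype.linearCombination k fun a => V.op i a u

theorem intervalHom_apply (V : FDComod k (LinearQuiverHopf k q)) (i : ℤ) (l : ℕ) (u : V.carrier)
    (f : Fin (l + 1) → k) : V.intervalHom i l u f = ∑ a, f a • V.op i a u := rfl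

theorem intervalHom_single (V : FDComod k (LinearQuiverHopf k q)) (i : ℤ) (l : ℕ)
    (u : V.carrier) (a : Fin (l + 1)) :
    V.intervalHom i l u (Pi.single a 1) = V.op i a u := by
  rw [intervalHom, Fintype.linearCombination_apply_single, one_smul]

theorem op_eq_zero_of_le {V : FDComod k (LinearQuiverHopf k q)} {i : ℤ} {l m : ℕ}
    {u : V.carrier} (h : V.op i l u = 0) (hm : l ≤ m) : V.op i m u = 0 := by
  obtain ⟨n, rfl⟩ := Nat.exists_eq_add_of_le hm
  rw [← V.op_op_of_eq rfl, h, map_zero]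

/-- The hypothesis takes care of the paths that leave the interval at its upper end; they act by
zero on `interval i l`, so they have to kill the image too. -/
theorem intervalHom_op {V : FDComod k (LinearQuiverHopf k q)} {i : ℤ} {l : ℕ} {u : V.carrier}
    (hu : V.op i (l + 1) u = 0) (j : ℤ) (b : ℕ) (f : Fin (l + 1) → k) :
    V.intervalHom i l u (intervalOp k i l j b f) = V.op j b (V.intervalHom i l u f) := by
  have : V.intervalHom i l u ∘ₗ intervalOp k i l j b = V.op j b ∘ₗ V.intervalHom i l u := by
    refine (Pi.basisFun k _).ext fun a => ?_
    rw [Pi.basisFun_apply, LinearMap.comp_apply, LinearMap.comp_apply, intervalHom_single,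
      op_op, intervalHom_apply]
    simp only [intervalOp_apply]
    split_ifs with h
    · subst h
      by_cases hab : (a : ℕ) + b < l + 1
      · rw [Finset.sum_eq_single_of_mem ⟨a + b, hab⟩ (Finset.mem_univ _)]
        · rw [if_pos ⟨by push_cast; ring, by simp⟩]
          simp
        · intro c _ hc
          rw [ite_eq_right_iff.2, zero_smul]
          rintro ⟨h1, h2⟩
          refine absurd (Fin.ext ?_) hc
          simp only
          omega
      · rw [op_eq_zero_of_le hu (by omega)]
        refine Finset.sum_eq_zero fun c _ => ?_
        rw [if_neg (by omega), zero_smul]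
    · refine Finset.sum_eq_zero fun c _ => ?_
      split_ifs with h1
      · rw [Pi.single_eq_of_ne, zero_smul]
        intro h2
        rw [Fin.ext_iff] at h2
        simp only at h2
        omega
      · rw [zero_smul]
  exact LinearMap.congr_fun this f

/-- The morphism to `interval i l` that is determined by a linear form. -/
def intervalProj (V : FDComod k (LinearQuiverHopf k q)) (i : ℤ) (l : ℕ)
    (φ : V.carrier →ₗ[k] k) : V.carrier →ₗ[k] (Fin (l + 1) → k) :=
  LinearMap.pi fun a => φ ∘ₗ V.op (i + (a : ℕ)) (l - a)

theorem intervalProj_apply (V : FDComod k (LinearQuiverHopf k q)) (i : ℤ) (l : ℕ)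
    (φ : V.carrier →ₗ[k] k) (v : V.carrier) (a : Fin (l + 1)) :
    V.intervalProj i l φ v a = φ (V.op (i + (a : ℕ)) (l - a) v) := rfl

/-- Dual to `intervalHom_op`: a path that enters the interval from below becomes longer than `l`
when it is continued to the top degree, so it has to act by zero on `V`. -/
theorem intervalProj_op {V : FDComod k (LinearQuiverHopf k q)} {l : ℕ}
    (hV : ∀ j, V.op j (l + 1) = 0) (i : ℤ) (φ : V.carrier →ₗ[k] k) (j : ℤ) (b : ℕ)
    (v : V.carrier) :
    V.intervalProj i l φ (V.op j b v) = intervalOp k i l j b (V.intervalProj i l φ v) := by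
  ext a
  rw [intervalOp_apply, intervalProj_apply, intervalProj_apply, op_op]
  by_cases h : i + (a : ℕ) = j + b
  · rw [if_pos h]
    by_cases hb : b ≤ a
    · rw [if_pos ⟨h, hb⟩]
      have h1 : i + ((a - b : ℕ) : ℤ) = j := by omega
      have h2 : l - (a - b) = b + (l - a) := by omega
      simp only [h1, h2]
    · rw [if_neg (by omega), op_eq_zero_of_le (l := l + 1), map_zero]
      · rw [hV, LinearMap.zero_apply]
      · omega
  · rw [if_neg h, if_neg (by omega), map_zero]

theorem intervalProj_intervalHom {V : FDComod k (LinearQuiverHopf k q)} {i : ℤ} {l : ℕ}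
    {u : V.carrier} {φ : V.carrier →ₗ[k] k} (hφ : φ (V.op i l u) = 1) (f : Fin (l + 1) → k) :
    V.intervalProj i l φ (V.intervalHom i l u f) = f := by
  ext a
  rw [intervalHom_apply, intervalProj_apply, map_sum, map_sum,
    Finset.sum_eq_single_of_mem a (Finset.mem_univ _)]
  · rw [map_smul, map_smul, op_op_of_eq _ rfl, Nat.add_sub_cancel' (by omega), hφ, smul_eq_mul,
      mul_one]
  · intro c _ hc
    rw [map_smul, op_op_of_ne, smul_zero, map_zero]
    intro h
    exact hc (Fin.ext (by omega))

/-- If the paths of length `l + 1` act by zero and some path of length `l` does not, then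
the comodule has a direct summand `interval i l`. -/
theorem exists_iso_interval_directSum {V : FDComod k (LinearQuiverHopf k q)} {i : ℤ} {l : ℕ}
    (hV : ∀ j, V.op j (l + 1) = 0) (h : V.op i l ≠ 0) :
    ∃ W, Iso ((interval q i l).directSum W) V := by
  obtain ⟨u, hu⟩ : ∃ u, V.op i l u ≠ 0 := by
    by_contra! h'
    exact h (LinearMap.ext h')
  obtain ⟨φ, hφ⟩ := Module.Projective.exists_dual_ne_zero k hu
  obtain ⟨φ, hφ⟩ : ∃ φ : V.carrier →ₗ[k] k, φ (V.op i l u) = 1 :=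
    ⟨(φ (V.op i l u))⁻¹ • φ, by simp [hφ]⟩
  set ι := V.intervalHom i l u with hι
  set π := V.intervalProj i l φ with hπ
  have hιop : ∀ j b f, ι (intervalOp k i l j b f) = V.op j b (ι f) :=
    intervalHom_op (by rw [hV, LinearMap.zero_apply])
  have hπop : ∀ j b v, π (V.op j b v) = intervalOp k i l j b (π v) :=
    intervalProj_op hV i φ
  have hπι : ∀ f, π (ι f) = f := intervalProj_intervalHom hφ
  -- Since π ∘ ι is the identity, id - ι ∘ π is an idempotent endomorphism with image ker π, which
  -- is the complementary summand.
  let b : V.carrier →ₗ[k] LinearMap.ker π :=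
    (LinearMap.id - ι ∘ₗ π).codRestrict _ fun v => by simp [hπι]
  have hb : ∀ v, (b v : V.carrier) = v - ι (π v) := fun v => rfl
  have hba : ∀ w : LinearMap.ker π, b w = w := fun w => by
    apply Subtype.ext
    rw [hb, w.2, map_zero, sub_zero]
  have hab : ∀ j m v, ((b (V.op j m v) : LinearMap.ker π) : V.carrier) = V.op j m (b v) := by
    intro j m v
    rw [hb, hb, map_sub, hπop, hιop]
  refine ⟨V.retract (LinearMap.ker π) (LinearMap.ker π).subtype b hba hab, ?_⟩
  let e : ((Fin (l + 1) → k) × LinearMap.ker π) ≃ₗ[k] V.carrier :=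
    LinearEquiv.ofLinearMap (ι.coprod (LinearMap.ker π).subtype) (π.prod b)
      (by ext v; simp [hb])
      (by
        ext x
        · simp [hπι]
        · simp [hπι, hb]
        · simp
        · simp [hba])
  have he : ∀ x, e x = ι x.1 + x.2 := fun x => rfl
  refine Iso.of_op e fun j m x => ?_
  refine Eq.trans (congrArg e (directSum_op _ _ j m x)) ?_
  refine Eq.trans ?_ (map_add (V.op j m) (ι x.1) x.2.1).symm
  refine congrArg₂ (fun a b : V.carrier => a + b) ?_ ?_
  · exact (congrArg ι (LinearMap.congr_fun (interval_op i l j m) x.1)).trans (hιop j m x.1)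
  · refine Eq.trans (congrArg Subtype.val (retract_op V _ _ b hba hab j m x.2)) ?_
    exact (hab j m _).trans (congrArg (fun w : LinearMap.ker π => V.op j m w) (hba x.2))

end

end FDComod

/-! ### Distributivity of the tensor product over direct sums -/

namespace FDComod

section

variable {k : Type u} [Field k] {H : Type v} [Ring H] [Bialgebra k H]

theorem tensor_directSum (U V W : FDComod k H) :
    Iso (U.tensor (V.directSum W)) ((U.tensor V).directSum (U.tensor W)) := by
  let e := TensorProduct.prodRight k k U.carrier V.carrier W.carrier
  refine ⟨e, TensorProduct.ext' fun u x => ?_⟩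
  have h1 := rTensor_mulCoeff (A := H) LinearMap.id (LinearMap.inl k V.carrier W.carrier)
    (U.coact u) (V.coact x.1)
  have h2 := rTensor_mulCoeff (A := H) LinearMap.id (LinearMap.inr k V.carrier W.carrier)
    (U.coact u) (W.coact x.2)
  rw [LinearMap.rTensor_id, LinearMap.id_apply] at h1 h2
  have e1 : e.toLinearMap ∘ₗ TensorProduct.map LinearMap.id (LinearMap.inl k V.carrier W.carrier)
      = LinearMap.inl k (U.carrier ⊗[k] V.carrier) (U.carrier ⊗[k] W.carrier) :=
    TensorProduct.ext' fun u v => by simp [e]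
  have e2 : e.toLinearMap ∘ₗ TensorProduct.map LinearMap.id (LinearMap.inr k V.carrier W.carrier)
      = LinearMap.inr k (U.carrier ⊗[k] V.carrier) (U.carrier ⊗[k] W.carrier) :=
    TensorProduct.ext' fun u v => by simp [e]
  have hx : (U.tensor (V.directSum W)).coact
      (u ⊗ₜ[k] x : U.carrier ⊗[k] (V.carrier × W.carrier))
      = mulCoeff U.carrier (V.carrier × W.carrier) H (U.coact u ⊗ₜ
          ((LinearMap.inl k V.carrier W.carrier).rTensor H (V.coact x.1)
            + (LinearMap.inr k V.carrier W.carrier).rTensor H (W.coact x.2))) := rfl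
  refine Eq.trans ?_ (congrArg (e.toLinearMap.rTensor H) hx).symm
  rw [TensorProduct.tmul_add, map_add, map_add, ← h1, ← h2, ← LinearMap.rTensor_comp_apply,
    ← LinearMap.rTensor_comp_apply, e1, e2]
  rfl

theorem directSum_tensor (U V W : FDComod k H) :
    Iso ((U.directSum V).tensor W) ((U.tensor W).directSum (V.tensor W)) := by
  let e := TensorProduct.prodLeft k k U.carrier V.carrier W.carrier
  refine ⟨e, TensorProduct.ext' fun x w => ?_⟩
  have h1 := rTensor_mulCoeff (A := H) (LinearMap.inl k U.carrier V.carrier) LinearMap.id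
    (U.coact x.1) (W.coact w)
  have h2 := rTensor_mulCoeff (A := H) (LinearMap.inr k U.carrier V.carrier) LinearMap.id
    (V.coact x.2) (W.coact w)
  rw [LinearMap.rTensor_id, LinearMap.id_apply] at h1 h2
  have e1 : e.toLinearMap ∘ₗ TensorProduct.map (LinearMap.inl k U.carrier V.carrier) LinearMap.id
      = LinearMap.inl k (U.carrier ⊗[k] W.carrier) (V.carrier ⊗[k] W.carrier) :=
    TensorProduct.ext' fun u v => by simp [e]
  have e2 : e.toLinearMap ∘ₗ TensorProduct.map (LinearMap.inr k U.carrier V.carrier) LinearMap.id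
      = LinearMap.inr k (U.carrier ⊗[k] W.carrier) (V.carrier ⊗[k] W.carrier) :=
    TensorProduct.ext' fun u v => by simp [e]
  have hx : ((U.directSum V).tensor W).coact
      (x ⊗ₜ[k] w : (U.carrier × V.carrier) ⊗[k] W.carrier)
      = mulCoeff (U.carrier × V.carrier) W.carrier H
          (((LinearMap.inl k U.carrier V.carrier).rTensor H (U.coact x.1)
            + (LinearMap.inr k U.carrier V.carrier).rTensor H (V.coact x.2)) ⊗ₜ W.coact w) := rfl
  refine Eq.trans ?_ (congrArg (e.toLinearMap.rTensor H) hx).symm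
  rw [TensorProduct.add_tmul, map_add, map_add, ← h1, ← h2, ← LinearMap.rTensor_comp_apply,
    ← LinearMap.rTensor_comp_apply, e1, e2]
  rfl

end

end FDComod

/-! ### Classes in the Green ring and extension of additive invariants -/

namespace GreenRing

section

variable {k : Type u} [Field k] {H : Type v} [Ring H] [Bialgebra k H]

/-- The projection to the Green ring. -/
def ofMonoidAlgebra (k : Type u) [Field k] (H : Type v) [Ring H] [Bialgebra k H] :
    MonoidAlgebra ℤ (ComodClass k H) →+* GreenRing k H :=
  RingQuot.mkRingHom (GreenRel k H)

/-- The class of a comodule in the Green ring. -/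
def cls (V : FDComod k H) : GreenRing k H :=
  ofMonoidAlgebra k H (MonoidAlgebra.of ℤ _ (ComodClass.mk V))

theorem cls_eq_of_iso {V W : FDComod k H} (h : FDComod.Iso V W) : cls V = cls W := by
  have : ComodClass.mk V = ComodClass.mk W := Quotient.sound h
  rw [cls, cls, this]

theorem cls_directSum (V W : FDComod k H) : cls (V.directSum W) = cls V + cls W :=
  (RingQuot.mkRingHom_rel (GreenRel.directSum V W)).trans (map_add (ofMonoidAlgebra k H) _ _)

theorem cls_tensor (V W : FDComod k H) : cls (V.tensor W) = cls V * cls W := by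
  have : ComodClass.mk (V.tensor W) = ComodClass.mk V * ComodClass.mk W := rfl
  rw [cls, this, map_mul, map_mul]
  rfl

theorem cls_unit : cls (FDComod.unit k H) = 1 := by
  have : ComodClass.mk (FDComod.unit k H) = 1 := rfl
  rw [cls, this, map_one, map_one]

/-- A zero comodule satisfies V ⊕ V ≅ V, hence [V] + [V] = [V]. -/
theorem cls_eq_zero {V : FDComod k H} (h : Module.finrank k V.carrier = 0) : cls V = 0 := by
  have hV : Subsingleton V.carrier := Module.finrank_zero_iff.1 h
  have : FDComod.Iso (V.directSum V) V := by
    refine ⟨LinearEquiv.ofLinearMap (LinearMap.fst k V.carrier V.carrier) 0 ?_ ?_, ?_⟩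
    · exact LinearMap.ext fun _ => @Subsingleton.elim V.carrier _ _ _
    · exact LinearMap.ext fun _ => @Subsingleton.elim (V.carrier × V.carrier) _ _ _
    · refine LinearMap.ext fun (x : V.carrier × V.carrier) => ?_
      have hx : x = 0 := @Subsingleton.elim (V.carrier × V.carrier) _ x 0
      rw [hx]
      exact (map_zero _).trans (map_zero _).symm
  have h2 := (cls_directSum V V).symm.trans (cls_eq_of_iso this)
  simpa using h2

theorem closure_range_cls : AddSubgroup.closure (Set.range (cls (k := k) (H := H))) = ⊤ := by
  rw [eq_top_iff]
  rintro x -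
  obtain ⟨a, rfl⟩ := RingQuot.mkRingHom_surjective (GreenRel k H) x
  induction a using MonoidAlgebra.induction_on with
  | of c =>
    obtain ⟨V, rfl⟩ := Quotient.exists_rep c
    exact AddSubgroup.subset_closure ⟨V, rfl⟩
  | add a b ha hb =>
    exact (map_add (ofMonoidAlgebra k H) a b).symm ▸ add_mem ha hb
  | smul n a ha =>
    exact (map_zsmul (ofMonoidAlgebra k H) n a).symm ▸ zsmul_mem ha n

/-- The congruence that is determined by an additive form on a ring: the largest one
that the form respects. -/
def formCon {A B : Type*} [Ring A] [AddCommGroup B] (r : A →+ B) : RingCon A where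
  r a b := ∀ s t, r (s * a * t) = r (s * b * t)
  iseqv := ⟨fun _ _ _ => rfl, fun h s t => (h s t).symm, fun h h' s t => (h s t).trans (h' s t)⟩
  add' h h' s t := by
    simp only [mul_add, add_mul, map_add]
    rw [h s t, h' s t]
  mul' {a b c d} h h' s t := by
    have h1 := h s (c * t)
    have h2 := h' (s * b) t
    simp only [mul_assoc] at h1 h2 ⊢
    exact h1.trans h2

/-- An additive invariant of comodules extends to the Green ring. -/
theorem exists_addMonoidHom (r : FDComod k H → ℤ) (hiso : ∀ V W, FDComod.Iso V W → r V = r W)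
    (hadd : ∀ V W : FDComod k H, r (V.directSum W) = r V + r W) :
    ∃ ρ : GreenRing k H →+ ℤ, ∀ V, ρ (cls V) = r V := by
  let r' : ComodClass k H → ℤ := Quotient.lift r hiso
  let R : MonoidAlgebra ℤ (ComodClass k H) →+ ℤ := MonoidAlgebra.liftNC (AddMonoidHom.id ℤ) r'
  have hR : ∀ V, R (MonoidAlgebra.of ℤ _ (ComodClass.mk V)) = r V := fun V => by
    simp only [R, MonoidAlgebra.of_apply, MonoidAlgebra.liftNC_single]
    exact one_mul _
  -- An additive invariant need not be multiplicative, so `RingQuot.lift` cannot be applied to it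
  -- directly; the target is the quotient by the congruence of the invariant. The relations hold
  -- there after multiplication by classes on both sides, because the tensor product is
  -- distributive.
  have hc : ∀ a b, GreenRel k H a b → (formCon R).mk' a = (formCon R).mk' b := by
    rintro _ _ ⟨V, W⟩
    refine (RingCon.eq _).2 fun s t => ?_
    induction s using MonoidAlgebra.induction_on with
    | add s s' hs hs' => simp only [add_mul, map_add, hs, hs']
    | smul n s hs => simp only [smul_mul_assoc, map_zsmul, hs]
    | of c =>
    induction t using MonoidAlgebra.induction_on with
    | add t t' ht ht' => simp only [mul_add, map_add] at ht ht' ⊢; rw [ht, ht']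
    | smul n t ht => simp only [mul_smul_comm, map_zsmul, ht]
    | of c' =>
    obtain ⟨U, rfl⟩ : ∃ U, ComodClass.mk U = c := Quotient.exists_rep c
    obtain ⟨U', rfl⟩ : ∃ U', ComodClass.mk U' = c' := Quotient.exists_rep c'
    have hm : ∀ X, MonoidAlgebra.of ℤ (ComodClass k H) (ComodClass.mk U)
        * MonoidAlgebra.of ℤ (ComodClass k H) (ComodClass.mk X)
        * MonoidAlgebra.of ℤ (ComodClass k H) (ComodClass.mk U')
        = MonoidAlgebra.of ℤ _ (ComodClass.mk ((U.tensor X).tensor U')) := fun X => by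
      rw [← map_mul, ← map_mul]
      rfl
    rw [mul_add, add_mul, map_add, hm, hm, hm, hR, hR, hR, ← hadd]
    exact hiso _ _ (((U.tensor_directSum V W).tensor (FDComod.Iso.refl _)).trans
      (FDComod.directSum_tensor _ _ _))
  let f : GreenRing k H →+* (formCon R).Quotient := RingQuot.lift ⟨(formCon R).mk', hc⟩
  have hf : ∀ V, f (cls V) = (formCon R).mk' (MonoidAlgebra.of ℤ _ (ComodClass.mk V)) := fun V =>
    RingQuot.lift_mkRingHom_apply _ hc _
  -- Taking both multipliers equal to 1 in the congruence shows that `R` descends to the quotient.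
  let g : (formCon R).Quotient →+ ℤ := AddMonoidHom.mk'
    (Quotient.lift R fun a b h => by simpa using h 1 1) (by
      rintro ⟨a⟩ ⟨b⟩
      exact map_add R a b)
  refine ⟨g.comp f.toAddMonoidHom, fun V => ?_⟩
  refine (congrArg g (hf V)).trans ?_
  exact hR V

end

end GreenRing

/-! ### Ranks of paths and comodules dominated by an interval -/

theorem LinearMap.finrank_range_tensorMap {k V W : Type*} [Field k] [AddCommGroup V] [Module k V]
    [AddCommGroup W] [Module k W] (f : V →ₗ[k] V) (g : W →ₗ[k] W) :
    Module.finrank k (LinearMap.range (TensorProduct.map f g))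
      = Module.finrank k (LinearMap.range f) * Module.finrank k (LinearMap.range g) := by
  rw [TensorProduct.range_map, ← TensorProduct.range_mapIncl, LinearMap.finrank_range_of_inj,
    Module.finrank_tensorProduct]
  exact TensorProduct.map_injective_of_flat_flat _ _ (Submodule.subtype_injective _)
    (Submodule.subtype_injective _)

theorem LinearMap.finrank_range_prodMap {k V W : Type*} [Field k] [AddCommGroup V] [Module k V]
    [AddCommGroup W] [Module k W] [FiniteDimensional k V] [FiniteDimensional k W]
    (f : V →ₗ[k] V) (g : W →ₗ[k] W) :
    Module.finrank k (LinearMap.range (f.prodMap g))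
      = Module.finrank k (LinearMap.range f) + Module.finrank k (LinearMap.range g) := by
  have h : LinearMap.range (f.prodMap g) = LinearMap.range
      ((LinearMap.range f).subtype.prodMap (LinearMap.range g).subtype) := by
    rw [LinearMap.range_prodMap, LinearMap.range_prodMap, Submodule.range_subtype,
      Submodule.range_subtype]
  rw [h, LinearMap.finrank_range_of_inj, Module.finrank_prod]
  exact Prod.map_injective.2 ⟨Subtype.val_injective, Subtype.val_injective⟩

namespace FDComod

open LinearQuiverHopf

section

variable {k : Type u} [Field k] {q : kˣ}

/-- The rank of the action of the path of length `l` with source `g ^ i`. -/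
def opRank (i : ℤ) (l : ℕ) (V : FDComod k (LinearQuiverHopf k q)) : ℕ :=
  Module.finrank k (LinearMap.range (V.op i l))

theorem opRank_eq_of_iso (i : ℤ) (l : ℕ) {V W : FDComod k (LinearQuiverHopf k q)}
    (h : Iso V W) : opRank i l V = opRank i l W := by
  obtain ⟨e, he⟩ := h
  have h1 : e.toLinearMap ∘ₗ V.op i l = W.op i l ∘ₗ e.toLinearMap :=
    LinearMap.ext (op_conj e he i l)
  have h2 := congrArg LinearMap.range h1
  rw [LinearMap.range_comp, LinearMap.range_comp_of_range_eq_top _ (LinearEquiv.range e)] at h2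
  rw [opRank, opRank, ← h2]
  exact (LinearEquiv.finrank_map_eq e _).symm

theorem opRank_directSum (i : ℤ) (l : ℕ) (V W : FDComod k (LinearQuiverHopf k q)) :
    opRank i l (V.directSum W) = opRank i l V + opRank i l W := by
  have h : (V.directSum W).op i l = (V.op i l).prodMap (W.op i l) :=
    LinearMap.ext (directSum_op V W i l)
  rw [opRank, h]
  exact LinearMap.finrank_range_prodMap _ _

theorem opRank_eq_zero_iff {i : ℤ} {l : ℕ} {V : FDComod k (LinearQuiverHopf k q)} :
    opRank i l V = 0 ↔ V.op i l = 0 := by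
  rw [opRank, Submodule.finrank_eq_zero, LinearMap.range_eq_bot]

/-- A comodule is dominated by `interval i n` if it lives in the degrees `i, …, i + n` and
the path from the first to the last of these degrees acts with rank one. -/
structure IsDominated (V : FDComod k (LinearQuiverHopf k q)) (i : ℤ) (n : ℕ) : Prop where
  bounds : ∀ j l, V.op j l ≠ 0 → i ≤ j ∧ j + l ≤ i + n
  opRank_eq_one : opRank i n V = 1

theorem IsDominated.op_eq_zero {V : FDComod k (LinearQuiverHopf k q)} {i : ℤ} {n : ℕ}
    (h : V.IsDominated i n) {l : ℕ} (hl : n < l) (j : ℤ) : V.op j l = 0 := by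
  by_contra h'
  have := h.bounds j l h'
  omega

theorem isDominated_interval (i : ℤ) (n : ℕ) : (interval q i n).IsDominated i n where
  bounds j l h := by
    rw [interval_op] at h
    contrapose! h
    ext f a
    change intervalOp k i n j l _ a = 0
    rw [intervalOp_apply, if_neg]
    · rintro ⟨h1, h2⟩
      have := h (by omega)
      omega
  opRank_eq_one := by
    rw [opRank, interval_op]
    change Module.finrank k (LinearMap.range (intervalOp k i n i n)) = 1
    have key : ∀ f, intervalOp k i n i n f = f 0 • Pi.single (Fin.last n) (1 : k) := by
      intro f
      ext a
      rw [intervalOp_apply, Pi.smul_apply]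
      by_cases h : a = Fin.last n
      · subst h
        rw [if_pos (by simp), Pi.single_eq_same, smul_eq_mul, mul_one]
        congr 1
        simp
      · rw [Pi.single_eq_of_ne h, smul_zero, if_neg]
        rintro ⟨h1, -⟩
        exact h (Fin.ext (by simpa using h1))
    refine finrank_eq_one_iff'.2 ⟨⟨Pi.single (Fin.last n) 1, Pi.single 0 1, ?_⟩, ?_, ?_⟩
    · rw [key, Pi.single_eq_same, one_smul]
    · intro h
      have := congrFun (congrArg Subtype.val h) (Fin.last n)
      simp at this
    · rintro ⟨_, f, rfl⟩
      exact ⟨f 0, Subtype.ext (key f).symm⟩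

/-- The bounds add up. For the extreme path they leave only the term in which each factor is acted
on by its own extreme path. It therefore acts by the tensor product of two rank one maps, times a
power of q and the Gaussian binomial. -/
theorem IsDominated.tensor {V W : FDComod k (LinearQuiverHopf k q)} {i j : ℤ} {n m : ℕ}
    (hV : V.IsDominated i n) (hW : W.IsDominated j m)
    (h : gaussBinom (q : k) (n + m) n ≠ 0) : (V.tensor W).IsDominated (i + j) (n + m) where
  bounds t c ht := by
    change V.tensorOp W t c ≠ 0 at ht
    contrapose! ht
    refine TensorProduct.ext' fun v w => ?_
    rw [tensorOp_tmul V W t c v w subset_rfl subset_rfl, LinearMap.zero_apply]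
    refine Finset.sum_eq_zero fun p _ => Finset.sum_eq_zero fun r _ => ?_
    split_ifs with hpr
    · by_cases h1 : V.op p.1 p.2 = 0
      · rw [h1, LinearMap.zero_apply, TensorProduct.zero_tmul, smul_zero]
      · by_cases h2 : W.op r.1 r.2 = 0
        · rw [h2, LinearMap.zero_apply, TensorProduct.tmul_zero, smul_zero]
        · have b1 := hV.bounds _ _ h1
          have b2 := hW.bounds _ _ h2
          have := ht (by omega)
          omega
    · rfl
  opRank_eq_one := by
    classical
    have key : V.tensorOp W (i + j) (n + m) = ((q : k) ^ (i * m) * gaussBinom (q : k) (n + m) n) •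
        TensorProduct.map (V.op i n) (W.op j m) := by
      refine TensorProduct.ext' fun v w => ?_
      rw [tensorOp_tmul V W _ _ v w (Finset.subset_insert (i, n) _)
        (Finset.subset_insert (j, m) _), ← Finset.sum_product',
        Finset.sum_eq_single_of_mem ((i, n), (j, m))]
      · simp
      · simp
      · rintro ⟨⟨i', n'⟩, ⟨j', m'⟩⟩ _ hne
        rw [ite_eq_right_iff]
        rintro ⟨h1, h2⟩
        dsimp only at h1 h2 ⊢
        by_cases h3 : V.op i' n' = 0
        · rw [h3, LinearMap.zero_apply, TensorProduct.zero_tmul, smul_zero]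
        · by_cases h4 : W.op j' m' = 0
          · rw [h4, LinearMap.zero_apply, TensorProduct.tmul_zero, smul_zero]
          · have b1 := hV.bounds _ _ h3
            have b2 := hW.bounds _ _ h4
            refine absurd ?_ hne
            simp only [Prod.mk.injEq]
            omega
    have h1 : opRank (i + j) (n + m) (V.tensor W)
        = Module.finrank k (LinearMap.range (V.tensorOp W (i + j) (n + m))) := rfl
    rw [h1, key, LinearMap.range_smul _ _ (mul_ne_zero (zpow_ne_zero _ q.ne_zero) h),
      LinearMap.finrank_range_tensorMap]
    have hv := hV.opRank_eq_one
    have hw := hW.opRank_eq_one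
    rw [opRank] at hv hw
    rw [hv, hw]

theorem finrank_tensor (V W : FDComod k (LinearQuiverHopf k q)) :
    Module.finrank k (V.tensor W).carrier
      = Module.finrank k V.carrier * Module.finrank k W.carrier :=
  Module.finrank_tensorProduct (R := k) (M := V.carrier) (M' := W.carrier)

theorem finrank_directSum (V W : FDComod k (LinearQuiverHopf k q)) :
    Module.finrank k (V.directSum W).carrier
      = Module.finrank k V.carrier + Module.finrank k W.carrier :=
  Module.finrank_prod (R := k) (M := V.carrier) (M' := W.carrier)

theorem Iso.finrank_eq {V W : FDComod k (LinearQuiverHopf k q)} (h : Iso V W) :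
    Module.finrank k V.carrier = Module.finrank k W.carrier := h.choose.finrank_eq

theorem eq_zero_of_op_eq_zero {V : FDComod k (LinearQuiverHopf k q)} (h : ∀ i, V.op i 0 = 0)
    (v : V.carrier) : v = 0 := by
  rw [← V.sum_op_zero v]
  refine Finset.sum_eq_zero fun p _ => ?_
  split_ifs with hp
  · rw [hp, h, LinearMap.zero_apply]
  · rfl

end

end FDComod

/-! ### Decomposition into intervals and leading summands -/

namespace GreenRing

open LinearQuiverHopf FDComod

section

variable {k : Type u} [Field k] {q : kˣ}

/-- The class of `interval i l`. -/
def intervalCls (q : kˣ) (i : ℤ) (l : ℕ) : GreenRing k (LinearQuiverHopf k q) :=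
  cls (interval q i l)

/-- The additive subgroup that is spanned by the classes of the intervals of length `< n`. -/
def lower (q : kˣ) (n : ℕ) : AddSubgroup (GreenRing k (LinearQuiverHopf k q)) :=
  AddSubgroup.closure {x | ∃ i l, l < n ∧ intervalCls q i l = x}

theorem lower_mono {m n : ℕ} (h : m ≤ n) : lower (k := k) q m ≤ lower q n :=
  AddSubgroup.closure_mono (by
    rintro x ⟨i, l, hl, rfl⟩
    exact ⟨i, l, by omega, rfl⟩)

/-- A longest path that acts in a nonzero way splits off an interval. Additivity of ranks shows that
the complement inherits the vanishing of long paths, and its dimension is smaller. -/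
theorem cls_mem_lower {n : ℕ} {V : FDComod k (LinearQuiverHopf k q)}
    (h : ∀ i l, n ≤ l → V.op i l = 0) : cls V ∈ lower q n := by
  induction hd : Module.finrank k V.carrier using Nat.strong_induction_on generalizing V n with
  | _ d ih =>
  subst hd
  induction n with
  | zero =>
    rw [cls_eq_zero]
    · exact zero_mem _
    · have : Subsingleton V.carrier := subsingleton_of_forall_eq 0
        (eq_zero_of_op_eq_zero fun i => h i 0 le_rfl)
      exact Module.finrank_zero_of_subsingleton
  | succ n ihn =>
    by_cases h' : ∀ i, V.op i n = 0
    · refine lower_mono n.le_succ (ihn fun i l hl => ?_)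
      rcases hl.eq_or_lt with rfl | hl
      · exact h' i
      · exact h i l hl
    · push Not at h'
      obtain ⟨i, hi⟩ := h'
      obtain ⟨W, hW⟩ := exists_iso_interval_directSum (fun j => h j (n + 1) le_rfl) hi
      rw [← cls_eq_of_iso hW, cls_directSum]
      refine add_mem (AddSubgroup.subset_closure ⟨i, n, n.lt_succ_self, rfl⟩) ?_
      have hd := hW.finrank_eq
      rw [finrank_directSum, finrank_interval] at hd
      refine ih (Module.finrank k W.carrier) (by omega) (fun j l hl => ?_) rfl
      have hr := opRank_eq_of_iso j l hW
      rw [opRank_directSum, opRank_eq_zero_iff.2 (h j l hl)] at hr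
      exact opRank_eq_zero_iff.1 (by omega)

theorem exists_cls_mem_lower (V : FDComod k (LinearQuiverHopf k q)) :
    ∃ n, cls V ∈ lower q n := by
  refine ⟨V.opSupport.sup Prod.snd + 1, cls_mem_lower fun i l hl => ?_⟩
  refine V.op_eq_zero (p := (i, l)) fun h => ?_
  have := Finset.le_sup (f := Prod.snd) h
  simp only at this
  omega

/-- This is the unitriangularity behind both generation and independence: the interval takes up the
whole rank of the extreme path, so the complement involves shorter intervals only. -/
theorem exists_cls_eq_add {V : FDComod k (LinearQuiverHopf k q)} {i : ℤ} {n : ℕ}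
    (hV : V.IsDominated i n) : ∃ W : FDComod k (LinearQuiverHopf k q),
      cls V = intervalCls q i n + cls W ∧ cls W ∈ lower q n ∧
        Module.finrank k V.carrier = n + 1 + Module.finrank k W.carrier := by
  have hne : V.op i n ≠ 0 := fun h => by
    have := hV.opRank_eq_one
    rw [opRank_eq_zero_iff.2 h] at this
    exact zero_ne_one this
  obtain ⟨W, hW⟩ := exists_iso_interval_directSum (hV.op_eq_zero n.lt_succ_self) hne
  refine ⟨W, by rw [← cls_eq_of_iso hW, cls_directSum, intervalCls], ?_, ?_⟩
  · refine cls_mem_lower fun j l hl => ?_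
    have hr := opRank_eq_of_iso j l hW
    rw [opRank_directSum] at hr
    refine opRank_eq_zero_iff.1 ?_
    -- If a path of length at least `n` acts on `V` in a nonzero way, the bounds make it the extreme
    -- path; its rank is one on `V` and on the interval, hence zero on `W`.
    by_cases h0 : V.op j l = 0
    · rw [opRank_eq_zero_iff.2 h0] at hr
      omega
    · have hb := hV.bounds j l h0
      obtain rfl : l = n := by omega
      obtain rfl : j = i := by omega
      rw [hV.opRank_eq_one, (isDominated_interval j l).opRank_eq_one] at hr
      omega
  · rw [← hW.finrank_eq, finrank_directSum, finrank_interval]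

theorem cls_eq_intervalCls {V : FDComod k (LinearQuiverHopf k q)} {i : ℤ} {n : ℕ}
    (hV : V.IsDominated i n) (hn : Module.finrank k V.carrier = n + 1) :
    cls V = intervalCls q i n := by
  obtain ⟨W, h1, -, h2⟩ := exists_cls_eq_add hV
  rw [h1, cls_eq_zero (by omega), add_zero]

/-- The Gaussian binomial is 1 here, and equality of dimensions leaves no room for a remainder. -/
theorem intervalCls_zero_mul (i j : ℤ) (l : ℕ) :
    intervalCls (k := k) q i 0 * intervalCls q j l = intervalCls q (i + j) l := by
  have h := (isDominated_interval (k := k) (q := q) i 0).tensor (isDominated_interval j l)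
    (by simp)
  rw [zero_add] at h
  rw [intervalCls, intervalCls, ← cls_tensor, cls_eq_intervalCls h]
  rw [finrank_tensor, finrank_interval, finrank_interval]
  ring

theorem intervalCls_mul_zero (i j : ℤ) (l : ℕ) :
    intervalCls (k := k) q j l * intervalCls q i 0 = intervalCls q (j + i) l := by
  have h := (isDominated_interval (k := k) (q := q) j l).tensor (isDominated_interval i 0)
    (by simp)
  rw [add_zero] at h
  rw [intervalCls, intervalCls, ← cls_tensor, cls_eq_intervalCls h]
  rw [finrank_tensor, finrank_interval, finrank_interval]
  ring

theorem unit_op (i : ℤ) (l : ℕ) (c : k) : (FDComod.unit k (LinearQuiverHopf k q)).op i l c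
    = if i = 0 ∧ l = 0 then c else (0 : k) := by
  have h : (FDComod.unit k (LinearQuiverHopf k q)).op i l c
      = pathCoeff i l (c ⊗ₜ[k] path q 0 0) := rfl
  rw [h, pathCoeff_tmul_path]
  simp only [eq_comm]
  rfl

theorem isDominated_unit : (FDComod.unit k (LinearQuiverHopf k q)).IsDominated 0 0 where
  bounds j l h := by
    contrapose! h
    refine LinearMap.ext fun (c : k) => ?_
    rw [unit_op, if_neg]
    · rfl
    · rintro ⟨rfl, rfl⟩
      simp at h
  opRank_eq_one := by
    have h : (FDComod.unit k (LinearQuiverHopf k q)).op 0 0 = (LinearMap.id : k →ₗ[k] k) :=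
      LinearMap.ext fun (c : k) => by rw [unit_op, if_pos ⟨rfl, rfl⟩]; rfl
    rw [opRank, h]
    exact (LinearEquiv.finrank_eq (LinearEquiv.ofTop _ LinearMap.range_id)).trans
      (Module.finrank_self k)

theorem intervalCls_zero_zero : intervalCls (k := k) q 0 0 = 1 := by
  rw [← cls_unit, cls_eq_intervalCls isDominated_unit]
  exact Module.finrank_self k

/-- The additive extension of `opRank` to the Green ring. -/
theorem exists_opRank_hom (i : ℤ) (l : ℕ) :
    ∃ ρ : GreenRing k (LinearQuiverHopf k q) →+ ℤ, ∀ V, ρ (cls V) = opRank i l V :=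
  exists_addMonoidHom (fun V => (opRank i l V : ℤ))
    (fun V W h => by rw [opRank_eq_of_iso i l h])
    (fun V W => by rw [opRank_directSum]; push_cast; rfl)

end

end GreenRing

/-! ### q-integers as Gaussian binomials -/

section Gauss

variable {k : Type*} [CommRing k] (q : k)

theorem qInt_zero : qInt q 0 = 0 := Finset.sum_range_zero _

theorem qInt_one : qInt q 1 = 1 := by simp [qInt]

theorem qInt_succ (n : ℕ) : qInt q (n + 1) = qInt q n + q ^ n := Finset.sum_range_succ _ _

theorem qInt_succ' (n : ℕ) : qInt q (n + 1) = 1 + q * qInt q n := by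
  rw [add_comm, qInt_add, qInt_one, pow_one]

theorem gaussBinom_succ_self (n : ℕ) : gaussBinom q (n + 1) n = qInt q (n + 1) := by
  induction n with
  | zero => simp [qInt_one]
  | succ n ih => rw [gaussBinom, ih, gaussBinom_self, qInt_succ q (n + 1), mul_one]

theorem gaussBinom_one_right (n : ℕ) : gaussBinom q n 1 = qInt q n := by
  induction n with
  | zero => rw [gaussBinom_eq_zero q zero_lt_one, qInt_zero]
  | succ n ih => rw [gaussBinom, ih, gaussBinom_zero_right, qInt_succ', pow_one]

end Gauss

/-! ### Tensor products with the interval of length one in coordinates -/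

namespace FDComod

open LinearQuiverHopf

section

variable {k : Type u} [Field k] {q : kˣ}

/-- The `j`-th coordinate vector of `k ^ (l + 1)`, or zero if `l < j`. -/
def coordVec (k : Type*) [Field k] (l j : ℕ) : Fin (l + 1) → k :=
  fun a => if (a : ℕ) = j then 1 else 0

theorem intervalOp_coordVec {i t : ℤ} {j : ℕ} (h : t = i + j) (l b : ℕ) :
    intervalOp k i l t b (coordVec k l j) = coordVec k l (j + b) := by
  funext a
  rw [intervalOp_apply]
  simp only [coordVec]
  split_ifs <;> first | rfl | omega

theorem span_range_coordVec (l : ℕ) : Submodule.span k (Set.range (coordVec k l)) = ⊤ := by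
  rw [eq_top_iff]
  rintro f -
  have hf : f = ∑ a : Fin (l + 1), f a • coordVec k l a := by
    funext b
    rw [Finset.sum_apply, Finset.sum_eq_single_of_mem b (Finset.mem_univ _)]
    · simp [coordVec]
    · intro c _ hc
      simp [coordVec, Fin.val_inj, hc.symm]
  rw [hf]
  exact Submodule.sum_mem _ fun a _ => Submodule.smul_mem _ _ (Submodule.subset_span ⟨a, rfl⟩)

/-- The basis vector of degree `i + j` of the comodule `interval i l`, or zero if `l < j`. -/
def intervalVec (q : kˣ) (i : ℤ) (l j : ℕ) : (interval q i l).carrier := coordVec k l j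

theorem intervalVec_eq_zero (i : ℤ) {l j : ℕ} (h : l < j) :
    intervalVec (k := k) q i l j = 0 :=
  funext fun a : Fin (l + 1) => if_neg (by have := a.is_lt; omega)

theorem op_intervalVec {i t : ℤ} {j : ℕ} (h : t = i + j) (l b : ℕ) :
    (interval q i l).op t b (intervalVec q i l j) = intervalVec (k := k) q i l (j + b) := by
  rw [interval_op]
  exact intervalOp_coordVec h l b

theorem isHomog_intervalVec {i t : ℤ} {j : ℕ} (h : t = i + j) (l : ℕ) :
    (interval q i l).IsHomog t (intervalVec (k := k) q i l j) := op_intervalVec h l 0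

theorem interval_tensor_eq_top {i i' : ℤ} {l l' : ℕ}
    {N : Submodule k ((interval q i l).carrier ⊗[k] (interval q i' l').carrier)}
    (h : ∀ a b, intervalVec q i l a ⊗ₜ[k] intervalVec q i' l' b ∈ N) : N = ⊤ := by
  have h1 : ∀ (i : ℤ) (l : ℕ), Submodule.span k (Set.range (intervalVec (k := k) q i l)) = ⊤ :=
    fun _ l => span_range_coordVec l
  rw [eq_top_iff, ← TensorProduct.map₂_mk_top_top_eq_top, ← h1 i l, ← h1 i' l',
    Submodule.map₂_span_span, Submodule.span_le]
  rintro _ ⟨_, ⟨a, rfl⟩, _, ⟨b, rfl⟩, rfl⟩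
  exact h a b

theorem tensorOp_intervalVec {l m a b : ℕ} {t : ℤ} (h : t = a + b) (c : ℕ) :
    (interval q 0 l).tensorOp (interval q 0 m) t c
        (intervalVec q 0 l a ⊗ₜ[k] intervalVec q 0 m b)
      = ∑ x ∈ Finset.HasAntidiagonal.antidiagonal c,
        ((q : k) ^ (a * x.2) * gaussBinom (q : k) c x.1) •
          (intervalVec q 0 l (a + x.1) ⊗ₜ[k] intervalVec q 0 m (b + x.2)) := by
  have ha : ((a : ℕ) : ℤ) = 0 + a := (zero_add _).symm
  have hb : ((b : ℕ) : ℤ) = 0 + b := (zero_add _).symm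
  rw [h, tensorOp_of_isHomog (isHomog_intervalVec ha l) (isHomog_intervalVec hb m)]
  refine Finset.sum_congr rfl fun x _ => ?_
  rw [op_intervalVec ha, op_intervalVec hb]
  norm_cast

theorem tensorOp_intervalVec_self {l m a b : ℕ} {t : ℤ} (h : t = a + b) :
    (interval q 0 l).tensorOp (interval q 0 m) t 0
        (intervalVec q 0 l a ⊗ₜ[k] intervalVec q 0 m b)
      = intervalVec q 0 l a ⊗ₜ[k] intervalVec q 0 m b := by
  rw [tensorOp_intervalVec h]
  simp

/-- The left factor can absorb at most one arrow, so two splittings survive; the second has the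
coefficient binom(c + 1, 1)_q. -/
theorem tensorOp_intervalVec_zero_left {l b : ℕ} {t : ℤ} (h : t = b) (c : ℕ) :
    (interval q 0 1).tensorOp (interval q 0 l) t (c + 1)
        (intervalVec q 0 1 0 ⊗ₜ[k] intervalVec q 0 l b)
      = intervalVec q 0 1 0 ⊗ₜ[k] intervalVec q 0 l (b + c + 1)
        + qInt (q : k) (c + 1) • (intervalVec q 0 1 1 ⊗ₜ[k] intervalVec q 0 l (b + c)) := by
  rw [tensorOp_intervalVec (by rw [h]; simp), Finset.Nat.sum_antidiagonal_succ,
    Finset.sum_eq_single_of_mem (0, c) (by simp)]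
  · simp [gaussBinom_one_right, add_assoc]
  · rintro ⟨x, y⟩ hxy hne
    rw [Finset.HasAntidiagonal.mem_antidiagonal] at hxy
    rw [intervalVec_eq_zero 0 (j := 0 + (x + 1)), TensorProduct.zero_tmul, smul_zero]
    by_contra h'
    exact hne (Prod.ext (by simp only at *; omega) (by simp only at *; omega))

theorem tensorOp_intervalVec_one_left {l b : ℕ} {t : ℤ} (h : t = 1 + b) (c : ℕ) :
    (interval q 0 1).tensorOp (interval q 0 l) t c
        (intervalVec q 0 1 1 ⊗ₜ[k] intervalVec q 0 l b)
      = (q : k) ^ c • (intervalVec q 0 1 1 ⊗ₜ[k] intervalVec q 0 l (b + c)) := by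
  rw [tensorOp_intervalVec (by rw [h]; simp), Finset.sum_eq_single_of_mem (0, c) (by simp)]
  · simp
  · rintro ⟨x, y⟩ hxy hne
    rw [Finset.HasAntidiagonal.mem_antidiagonal] at hxy
    rw [intervalVec_eq_zero 0 (j := 1 + x), TensorProduct.zero_tmul, smul_zero]
    by_contra h'
    exact hne (Prod.ext (by simp only at *; omega) (by simp only at *; omega))

/-- As on the other side, but the degree `b` of the left vector now contributes a power of q when
the right factor absorbs an arrow. -/
theorem tensorOp_intervalVec_zero_right {l b : ℕ} {t : ℤ} (h : t = b) (c : ℕ) :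
    (interval q 0 l).tensorOp (interval q 0 1) t (c + 1)
        (intervalVec q 0 l b ⊗ₜ[k] intervalVec q 0 1 0)
      = intervalVec q 0 l (b + c + 1) ⊗ₜ[k] intervalVec q 0 1 0
        + ((q : k) ^ b * qInt (q : k) (c + 1)) •
          (intervalVec q 0 l (b + c) ⊗ₜ[k] intervalVec q 0 1 1) := by
  rw [tensorOp_intervalVec (by rw [h]; simp), Finset.Nat.sum_antidiagonal_succ',
    Finset.sum_eq_single_of_mem (c, 0) (by simp)]
  · simp [gaussBinom_succ_self, add_assoc]
  · rintro ⟨x, y⟩ hxy hne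
    rw [Finset.HasAntidiagonal.mem_antidiagonal] at hxy
    rw [intervalVec_eq_zero 0 (j := 0 + (y + 1)), TensorProduct.tmul_zero, smul_zero]
    by_contra h'
    exact hne (Prod.ext (by simp only at *; omega) (by simp only at *; omega))

theorem tensorOp_intervalVec_one_right {l b : ℕ} {t : ℤ} (h : t = 1 + b) (c : ℕ) :
    (interval q 0 l).tensorOp (interval q 0 1) t c
        (intervalVec q 0 l b ⊗ₜ[k] intervalVec q 0 1 1)
      = intervalVec (k := k) q 0 l (b + c) ⊗ₜ[k] intervalVec q 0 1 1 := by
  rw [tensorOp_intervalVec (by rw [h, add_comm]; simp),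
    Finset.sum_eq_single_of_mem (c, 0) (by simp)]
  · simp
  · rintro ⟨x, y⟩ hxy hne
    rw [Finset.HasAntidiagonal.mem_antidiagonal] at hxy
    rw [intervalVec_eq_zero 0 (j := 1 + y), TensorProduct.tmul_zero, smul_zero]
    by_contra h'
    exact hne (Prod.ext (by simp only at *; omega) (by simp only at *; omega))

/-- A comodule of the right dimension that is generated by two vectors is a sum of intervals. -/
theorem iso_directSum_interval {V : FDComod k (LinearQuiverHopf k q)} {i i' : ℤ} {l l' : ℕ}
    {u u' : V.carrier} (hu : V.IsHomog i u) (hu' : V.IsHomog i' u')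
    (h : V.op i (l + 1) u = 0) (h' : V.op i' (l' + 1) u' = 0)
    (hV : Module.finrank k V.carrier = l + 1 + (l' + 1))
    (hN : ∀ N : Submodule k V.carrier, (∀ j m, ∀ v ∈ N, V.op j m v ∈ N) → u ∈ N → u' ∈ N →
      N = ⊤) : Iso ((interval q i l).directSum (interval q i' l')) V := by
  let f : ((Fin (l + 1) → k) × (Fin (l' + 1) → k)) →ₗ[k] V.carrier :=
    (V.intervalHom i l u).coprod (V.intervalHom i' l' u')
  have hf : ∀ x, f x = V.intervalHom i l u x.1 + V.intervalHom i' l' u' x.2 := fun x => rfl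
  have hop : ∀ j m x, f (intervalOp k i l j m x.1, intervalOp k i' l' j m x.2)
      = V.op j m (f x) := by
    intro j m x
    rw [hf, hf, map_add, intervalHom_op h, intervalHom_op h']
  have hsurj : Function.Surjective f := by
    rw [← LinearMap.range_eq_top]
    refine hN _ ?_ ?_ ?_
    · rintro j m _ ⟨x, rfl⟩
      exact ⟨_, hop j m x⟩
    · refine ⟨(Pi.single 0 1, 0), ?_⟩
      rw [hf, intervalHom_single, map_zero, add_zero]
      exact hu
    · refine ⟨(0, Pi.single 0 1), ?_⟩
      rw [hf, intervalHom_single, map_zero, zero_add]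
      exact hu'
  -- The dimensions agree, so generation by the two vectors is enough.
  have hinj : Function.Injective f := by
    refine (LinearMap.injective_iff_surjective_of_finrank_eq_finrank ?_).2 hsurj
    rw [Module.finrank_prod, Module.finrank_fin_fun, Module.finrank_fin_fun, hV]
  refine Iso.of_op (LinearEquiv.ofBijective f ⟨hinj, hsurj⟩) fun j m x => ?_
  refine Eq.trans (congrArg f (directSum_op _ _ j m x)) (Eq.trans ?_ (hop j m x))
  rw [interval_op, interval_op]
  rfl

end

end FDComod

/-! ### Clebsch–Gordan rules -/

namespace GreenRing

open LinearQuiverHopf FDComod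

section

variable {k : Type u} [Field k] {q : kˣ}

/-- This is `iso_directSum_interval` phrased through `tensorOp` on the plain tensor product, the
form in which the coordinate formulas apply. -/
theorem cls_mul_cls_eq {V W : FDComod k (LinearQuiverHopf k q)} {i i' : ℤ} {l l' : ℕ}
    {u u' : V.carrier ⊗[k] W.carrier} (hu : V.tensorOp W i 0 u = u)
    (hu' : V.tensorOp W i' 0 u' = u')
    (h : V.tensorOp W i (l + 1) u = 0) (h' : V.tensorOp W i' (l' + 1) u' = 0)
    (hV : Module.finrank k V.carrier * Module.finrank k W.carrier = l + 1 + (l' + 1))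
    (hN : ∀ N : Submodule k (V.carrier ⊗[k] W.carrier),
      (∀ j m, ∀ v ∈ N, V.tensorOp W j m v ∈ N) → u ∈ N → u' ∈ N → N = ⊤) :
    cls V * cls W = intervalCls q i l + intervalCls q i' l' := by
  rw [← cls_tensor, intervalCls, intervalCls, ← cls_directSum]
  exact (cls_eq_of_iso (iso_directSum_interval (V := V.tensor W) hu hu' h h'
    (by rw [finrank_tensor, hV]) hN)).symm

theorem intervalCls_one_mul {n : ℕ} (h : qInt (q : k) (n + 2) ≠ 0) :
    intervalCls q 0 1 * intervalCls q 0 (n + 1)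
      = intervalCls q 0 (n + 2) + intervalCls q 1 n := by
  -- The second generator is the combination in degree 1 that the path of length n + 1 kills: that
  -- path sends both basis vectors of degree 1 to multiples of the top vector, by q ^ (n + 1) and by
  -- the q-integer of n + 1.
  refine cls_mul_cls_eq (u := intervalVec q 0 1 0 ⊗ₜ[k] intervalVec q 0 (n + 1) 0)
    (u' := qInt (q : k) (n + 1) • (intervalVec q 0 1 1 ⊗ₜ[k] intervalVec q 0 (n + 1) 0)
      - (q : k) ^ (n + 1) • (intervalVec q 0 1 0 ⊗ₜ[k] intervalVec q 0 (n + 1) 1))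
    (tensorOp_intervalVec_self (by simp)) ?_ ?_ ?_ ?_ ?_
  · rw [map_sub, map_smul, map_smul, tensorOp_intervalVec_self (by simp),
      tensorOp_intervalVec_self (by simp)]
  · rw [tensorOp_intervalVec_zero_left (by simp),
      intervalVec_eq_zero 0 (j := 0 + (n + 1 + 1) + 1) (by omega),
      intervalVec_eq_zero 0 (j := 0 + (n + 1 + 1)) (by omega)]
    simp
  · rw [map_sub, map_smul, map_smul, tensorOp_intervalVec_one_left (by simp),
      tensorOp_intervalVec_zero_left (by simp), intervalVec_eq_zero 0 (j := 1 + n + 1) (by omega),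
      TensorProduct.tmul_zero, zero_add, zero_add, smul_smul, smul_smul, mul_comm,
      add_comm 1 n, sub_self]
  · rw [finrank_interval, finrank_interval]
    ring
  · intro N hN hu hu'
    have h1 := hN 0 1 _ hu
    rw [tensorOp_intervalVec_zero_left (c := 0) (by simp), zero_add, zero_add, qInt_one,
      one_smul, add_comm (_ ⊗ₜ[k] _)] at h1
    -- The vector reached from `u` by one arrow cancels the second term of `u'` and leaves the
    -- q-integer of n + 2 times e₁ ⊗ f₀. This is where its nonvanishing is needed.
    have h2 := add_mem hu' (N.smul_mem ((q : k) ^ (n + 1)) h1)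
    rw [smul_add, sub_add_add_cancel, ← add_smul, ← qInt_succ] at h2
    have h3 := (N.smul_mem_iff h).1 h2
    have h4 : ∀ j, intervalVec q 0 1 1 ⊗ₜ[k] intervalVec q 0 (n + 1) j ∈ N := fun j => by
      have := hN 1 j _ h3
      rw [tensorOp_intervalVec_one_left (by simp), zero_add] at this
      exact (N.smul_mem_iff (pow_ne_zero _ q.ne_zero)).1 this
    have h5 : ∀ j, intervalVec q 0 1 0 ⊗ₜ[k] intervalVec q 0 (n + 1) j ∈ N := by
      rintro (_ | j)
      · exact hu
      · have := hN 0 (j + 1) _ hu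
        rw [tensorOp_intervalVec_zero_left (by simp), zero_add] at this
        exact (N.add_mem_iff_left (N.smul_mem _ (h4 j))).1 this
    refine interval_tensor_eq_top ?_
    rintro (_ | _ | a) b
    · exact h5 b
    · exact h4 b
    · rw [intervalVec_eq_zero 0 (by omega), TensorProduct.zero_tmul]
      exact N.zero_mem

/-- The other order of the factors needs its own generators; comparison with `intervalCls_one_mul`
is what later shows that y and z commute. -/
theorem intervalCls_mul_one {n : ℕ} (h : qInt (q : k) (n + 2) ≠ 0) :
    intervalCls q 0 (n + 1) * intervalCls q 0 1
      = intervalCls q 0 (n + 2) + intervalCls q 1 n := by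
  -- Again the second generator is the combination killed by the path of length n + 1. The factor q
  -- comes from the left vector of degree 1, and q times the q-integer of n + 1, plus 1, is the
  -- q-integer of n + 2.
  refine cls_mul_cls_eq (u := intervalVec q 0 (n + 1) 0 ⊗ₜ[k] intervalVec q 0 1 0)
    (u' := ((q : k) * qInt (q : k) (n + 1)) •
        (intervalVec q 0 (n + 1) 0 ⊗ₜ[k] intervalVec q 0 1 1)
      - intervalVec q 0 (n + 1) 1 ⊗ₜ[k] intervalVec q 0 1 0)
    (tensorOp_intervalVec_self (by simp)) ?_ ?_ ?_ ?_ ?_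
  · rw [map_sub, map_smul, tensorOp_intervalVec_self (by simp),
      tensorOp_intervalVec_self (by simp)]
  · rw [tensorOp_intervalVec_zero_right (by simp),
      intervalVec_eq_zero 0 (j := 0 + (n + 1 + 1) + 1) (by omega),
      intervalVec_eq_zero 0 (j := 0 + (n + 1 + 1)) (by omega)]
    simp
  · rw [map_sub, map_smul, tensorOp_intervalVec_one_right (by simp),
      tensorOp_intervalVec_zero_right (by simp), intervalVec_eq_zero 0 (j := 1 + n + 1) (by omega),
      TensorProduct.zero_tmul, zero_add, zero_add, add_comm 1 n, pow_one, sub_self]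
  · rw [finrank_interval, finrank_interval]
    ring
  · intro N hN hu hu'
    have h1 := hN 0 1 _ hu
    rw [tensorOp_intervalVec_zero_right (c := 0) (by simp), zero_add, zero_add, qInt_one,
      pow_zero, one_mul, one_smul, add_comm (_ ⊗ₜ[k] _)] at h1
    have h2 := add_mem hu' h1
    rw [sub_add_add_cancel] at h2
    have h3 : intervalVec q 0 (n + 1) 0 ⊗ₜ[k] intervalVec q 0 1 1 ∈ N := by
      rwa [← N.smul_mem_iff h, qInt_succ', add_smul, one_smul, add_comm (_ ⊗ₜ[k] _)]
    have h4 : ∀ j, intervalVec q 0 (n + 1) j ⊗ₜ[k] intervalVec q 0 1 1 ∈ N := fun j => by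
      have := hN 1 j _ h3
      rwa [tensorOp_intervalVec_one_right (by simp), zero_add] at this
    have h5 : ∀ j, intervalVec q 0 (n + 1) j ⊗ₜ[k] intervalVec q 0 1 0 ∈ N := by
      rintro (_ | j)
      · exact hu
      · have := hN 0 (j + 1) _ hu
        rw [tensorOp_intervalVec_zero_right (by simp), zero_add] at this
        exact (N.add_mem_iff_left (N.smul_mem _ (h4 j))).1 this
    refine interval_tensor_eq_top ?_
    rintro a (_ | _ | b)
    · exact h5 a
    · exact h4 a
    · rw [intervalVec_eq_zero 0 (j := b + 1 + 1) (by omega), TensorProduct.tmul_zero]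
      exact N.zero_mem

/-- When the q-integer vanishes, the path of length n + 1 kills e₀ ⊗ f₀, so this vector generates an
interval of length n only, and e₁ ⊗ f₀ generates a complement. -/
theorem intervalCls_one_mul_of_qInt_eq_zero {n : ℕ} (h : qInt (q : k) (n + 1) = 0) :
    intervalCls q 0 1 * intervalCls q 0 n = intervalCls q 0 n + intervalCls q 1 n := by
  refine cls_mul_cls_eq (u := intervalVec q 0 1 0 ⊗ₜ[k] intervalVec q 0 n 0)
    (u' := intervalVec q 0 1 1 ⊗ₜ[k] intervalVec q 0 n 0)
    (tensorOp_intervalVec_self (by simp)) (tensorOp_intervalVec_self (by simp)) ?_ ?_ ?_ ?_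
  · rw [tensorOp_intervalVec_zero_left (by simp), intervalVec_eq_zero 0 (j := 0 + n + 1) (by omega),
      h]
    simp
  · rw [tensorOp_intervalVec_one_left (by simp), intervalVec_eq_zero 0 (j := 0 + (n + 1)) (by omega)]
    simp
  · rw [finrank_interval, finrank_interval]
    ring
  · intro N hN hu hu'
    have h4 : ∀ j, intervalVec q 0 1 1 ⊗ₜ[k] intervalVec q 0 n j ∈ N := fun j => by
      have := hN 1 j _ hu'
      rw [tensorOp_intervalVec_one_left (by simp), zero_add] at this
      exact (N.smul_mem_iff (pow_ne_zero _ q.ne_zero)).1 this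
    have h5 : ∀ j, intervalVec q 0 1 0 ⊗ₜ[k] intervalVec q 0 n j ∈ N := by
      rintro (_ | j)
      · exact hu
      · have := hN 0 (j + 1) _ hu
        rw [tensorOp_intervalVec_zero_left (by simp), zero_add] at this
        exact (N.add_mem_iff_left (N.smul_mem _ (h4 j))).1 this
    refine interval_tensor_eq_top ?_
    rintro (_ | _ | a) b
    · exact h5 b
    · exact h4 b
    · rw [intervalVec_eq_zero 0 (by omega), TensorProduct.zero_tmul]
      exact N.zero_mem

end

end GreenRing

/-! ### Gaussian binomials at a root of unity -/

section Gauss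

variable {k : Type*} [Field k] {q : k} {d : ℕ}

theorem qInt_eq_zero_iff (hq : IsPrimitiveRoot q d) (hd : 2 ≤ d) (n : ℕ) :
    qInt q n = 0 ↔ d ∣ n := by
  have h1 : q - 1 ≠ 0 := sub_ne_zero.2 (hq.ne_one (by omega))
  have h : qInt q n * (q - 1) = q ^ n - 1 := geom_sum_mul q n
  rw [← hq.pow_eq_one_iff_dvd, ← sub_eq_zero (a := q ^ n), ← h, mul_eq_zero, or_iff_left h1]

theorem qFactorial_ne_zero (hq : IsPrimitiveRoot q d) (hd : 2 ≤ d) {n : ℕ} (hn : n < d) :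
    qFactorial q n ≠ 0 := by
  refine Finset.prod_ne_zero_iff.2 fun i hi => ?_
  rw [Finset.mem_range] at hi
  rw [Ne, qInt_eq_zero_iff hq hd]
  intro h
  have := Nat.le_of_dvd (by omega) h
  omega

/-- In the factorial identity the q-factorial of d vanishes while those of smaller numbers do not.
-/
theorem gaussBinom_order (hq : IsPrimitiveRoot q d) (hd : 2 ≤ d) {n : ℕ} (h0 : n ≠ 0)
    (hn : n ≠ d) : gaussBinom q d n = 0 := by
  rcases lt_or_ge d n with h | h
  · exact gaussBinom_eq_zero q h
  obtain ⟨m, rfl⟩ := Nat.exists_eq_add_of_le h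
  have h1 := gaussBinom_mul_qFactorial q n m
  have h2 : qFactorial q (n + m) = 0 := by
    refine Finset.prod_eq_zero (Finset.mem_range.2 (show n + m - 1 < n + m by omega)) ?_
    rw [qInt_eq_zero_iff hq hd, show n + m - 1 + 1 = n + m by omega]
  rw [h2, mul_eq_zero] at h1
  refine h1.resolve_right (mul_ne_zero ?_ ?_)
  · exact qFactorial_ne_zero hq hd (by omega)
  · exact qFactorial_ne_zero hq hd (by omega)

/-- This is `gaussBinom_vandermonde` with the test function supported at (l, m), which forces the
second split to start with the second part of the first one. -/
theorem gaussBinom_add_eq_sum (q : k) (l m : ℕ) :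
    gaussBinom q (l + m) l = ∑ x ∈ Finset.HasAntidiagonal.antidiagonal l,
      q ^ (x.2 * x.2) * (gaussBinom q l x.1 * gaussBinom q m x.2) := by
  have h := gaussBinom_vandermonde q l m fun u c => if u = l ∧ c = m then (1 : k) else 0
  rw [Finset.sum_eq_single_of_mem (a := (l, m))
    (s := Finset.HasAntidiagonal.antidiagonal (l + m)) (by simp)] at h
  · rw [if_pos ⟨rfl, rfl⟩, smul_eq_mul, mul_one] at h
    rw [← h]
    refine Finset.sum_congr rfl ?_
    rintro ⟨a, b⟩ hab
    rw [Finset.HasAntidiagonal.mem_antidiagonal] at hab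
    dsimp only at hab ⊢
    by_cases hb : b ≤ m
    · rw [Finset.sum_eq_single_of_mem (b, m - b) (by simpa using by omega)]
      · dsimp only
        rw [if_pos (by omega), hab, Nat.add_sub_cancel' hb, smul_eq_mul, mul_one]
      · rintro ⟨c, e⟩ hce hne
        rw [if_neg, smul_zero]
        rintro ⟨h1, h2⟩
        exact hne (Prod.ext (by dsimp only at *; omega) (by dsimp only at *; omega))
    · rw [gaussBinom_eq_zero q (n := m) (by omega), mul_zero, mul_zero]
      refine Finset.sum_eq_zero ?_
      rintro ⟨c, e⟩ hce
      rw [if_neg (by dsimp only; omega), smul_zero]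
  · rintro ⟨a, b⟩ _ hne
    refine if_neg ?_
    rintro ⟨h1, h2⟩
    exact hne (Prod.ext h1 h2)

/-- By `gaussBinom_order` only the two extreme terms of the Vandermonde sum survive. One is 1, and
the other is the previous value, since the exponent d² of q is a multiple of d. -/
theorem gaussBinom_mul_order (hq : IsPrimitiveRoot q d) (hd : 2 ≤ d) (b : ℕ) :
    gaussBinom q (b * d + d) (b * d) = b + 1 := by
  induction b with
  | zero => simp
  | succ b ih =>
    rw [gaussBinom_add_eq_sum, Finset.sum_eq_add_of_mem ((b + 1) * d, 0) (b * d, d) (by simp)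
      (by simp [add_mul])]
    · have : (b + 1) * d = b * d + d := by ring
      simp only [this]
      rw [ih, gaussBinom_self, gaussBinom_self, gaussBinom_zero_right, pow_mul q d,
        hq.pow_eq_one, one_pow, mul_zero, pow_zero]
      push_cast
      ring
    · intro h
      have := congrArg Prod.snd h
      simp only at this
      omega
    · rintro ⟨x, y⟩ hxy ⟨h1, h2⟩
      rw [Finset.HasAntidiagonal.mem_antidiagonal] at hxy
      have e : (b + 1) * d = b * d + d := by ring
      rw [gaussBinom_order hq hd (n := y), mul_zero, mul_zero]
      · rintro rfl
        exact h1 (Prod.ext (by simpa using hxy) rfl)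
      · rintro rfl
        refine h2 (Prod.ext ?_ rfl)
        dsimp only at *
        omega

end Gauss

/-! ### Generators, commutativity and independent monomials -/

namespace GreenRing

open LinearQuiverHopf FDComod

section

variable {k : Type u} [Field k] {q : kˣ} {d : ℕ}

theorem isPrimitiveRoot_of_orderOf (hq : orderOf q = d) : IsPrimitiveRoot (q : k) d := by
  rw [IsPrimitiveRoot.coe_units_iff, ← hq]
  exact IsPrimitiveRoot.orderOf q

/-- The monomials in the classes of the intervals of length `0`, `1` and `d`, the exponent of the
class of length `1` being less than `d`. -/
def monomialCls (q : kˣ) (d : ℕ) (p : ℕ × ℤ) : GreenRing k (LinearQuiverHopf k q) :=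
  intervalCls q p.2 0 * intervalCls q 0 d ^ (p.1 / d) * intervalCls q 0 1 ^ (p.1 % d)

/-- One factor is added at a time, all copies of z before those of y. A factor z contributes the
Gaussian binomial b + 1, which is nonzero by characteristic zero; a factor y contributes the
q-integer of bd + a + 1, which is nonzero as a + 1 < d. -/
theorem exists_isDominated_mul_pow [CharZero k] (hd : 2 ≤ d) (hq : IsPrimitiveRoot (q : k) d)
    (i : ℤ) (b a : ℕ) (ha : a < d) : ∃ V : FDComod k (LinearQuiverHopf k q),
      cls V = intervalCls q i 0 * intervalCls q 0 d ^ b * intervalCls q 0 1 ^ a ∧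
        V.IsDominated i (b * d + a) := by
  induction a with
  | zero =>
    induction b with
    | zero => exact ⟨interval q i 0, by simp [intervalCls], by simpa using isDominated_interval i 0⟩
    | succ b ih =>
      obtain ⟨V, h1, h2⟩ := ih
      rw [pow_zero, mul_one] at h1
      refine ⟨V.tensor (interval q 0 d), ?_, ?_⟩
      · rw [cls_tensor, h1, pow_zero, mul_one, pow_succ, mul_assoc]
        rfl
      · have h := h2.tensor (isDominated_interval (q := q) 0 d) (by
          rw [add_zero, gaussBinom_mul_order hq hd]
          exact Nat.cast_add_one_ne_zero b)
        have e : (b + 1) * d + 0 = b * d + 0 + d := by ring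
        rw [e]
        simpa using h
  | succ a ih =>
    obtain ⟨V, h1, h2⟩ := ih (by omega)
    refine ⟨V.tensor (interval q 0 1), ?_, ?_⟩
    · rw [cls_tensor, h1, pow_succ, mul_assoc, mul_assoc, mul_assoc]
      rfl
    · have h := h2.tensor (isDominated_interval (q := q) 0 1) (by
        rw [gaussBinom_succ_self, Ne, qInt_eq_zero_iff hq hd, add_assoc,
          Nat.dvd_add_right (Dvd.intro_left b rfl)]
        intro h
        have := Nat.le_of_dvd (by omega) h
        omega)
      simpa [add_assoc] using h

theorem exists_isDominated_monomialCls [CharZero k] (hd : 2 ≤ d)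
    (hq : IsPrimitiveRoot (q : k) d) (p : ℕ × ℤ) : ∃ V : FDComod k (LinearQuiverHopf k q),
      cls V = monomialCls q d p ∧ V.IsDominated p.2 p.1 := by
  obtain ⟨V, h1, h2⟩ := exists_isDominated_mul_pow hd hq p.2 (p.1 / d) (p.1 % d)
    (Nat.mod_lt _ (by omega))
  rw [Nat.div_add_mod'] at h2
  exact ⟨V, h1, h2⟩

/-- Induction on the length: each interval class differs from a monomial in the generators by
shorter intervals. -/
theorem subring_eq_top [CharZero k] (hd : 2 ≤ d) (hq : IsPrimitiveRoot (q : k) d)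
    (S : Subring (GreenRing k (LinearQuiverHopf k q))) (hx : ∀ i, intervalCls q i 0 ∈ S)
    (hy : intervalCls q 0 1 ∈ S) (hz : intervalCls q 0 d ∈ S) : S = ⊤ := by
  have hM : ∀ n i, intervalCls q i n ∈ S := by
    intro n
    induction n using Nat.strong_induction_on with
    | _ n ih =>
    intro i
    obtain ⟨V, h1, h2⟩ := exists_isDominated_monomialCls hd hq (n, i)
    obtain ⟨W, h3, h4, -⟩ := exists_cls_eq_add h2
    have hl : lower q n ≤ S.toAddSubgroup := by
      refine (AddSubgroup.closure_le _).2 ?_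
      rintro _ ⟨j, l, hl, rfl⟩
      exact ih l hl j
    have hV : cls V ∈ S := by
      rw [h1]
      exact mul_mem (mul_mem (hx i) (pow_mem hz _)) (pow_mem hy _)
    rw [h3] at hV
    exact (add_mem_cancel_right (hl h4)).1 hV
  have htop : (⊤ : AddSubgroup (GreenRing k (LinearQuiverHopf k q))) ≤ S.toAddSubgroup := by
    rw [← closure_range_cls, AddSubgroup.closure_le]
    rintro _ ⟨V, rfl⟩
    obtain ⟨n, hn⟩ := exists_cls_mem_lower V
    refine (AddSubgroup.closure_le _).2 ?_ hn
    rintro _ ⟨j, l, -, rfl⟩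
    exact hM l j
  exact eq_top_iff.2 fun x _ => htop (AddSubgroup.mem_top x)

/-- It is enough that the generators commute. Those of length 0 shift degrees from either side, and
both products of y and z equal [M(0, d + 1)] + [M(1, d - 1)], because the q-integer of d + 1 is
nonzero. -/
theorem green_mul_comm [CharZero k] (hd : 2 ≤ d) (hq : IsPrimitiveRoot (q : k) d)
    (a b : GreenRing k (LinearQuiverHopf k q)) : a * b = b * a := by
  have hx : ∀ i j l, intervalCls (k := k) q i 0 * intervalCls q j l
      = intervalCls q j l * intervalCls q i 0 := fun i j l => by
    rw [intervalCls_zero_mul, intervalCls_mul_zero, add_comm]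
  have hyz : intervalCls (k := k) q 0 1 * intervalCls q 0 d
      = intervalCls q 0 d * intervalCls q 0 1 := by
    obtain ⟨n, rfl⟩ := Nat.exists_eq_succ_of_ne_zero (show d ≠ 0 by omega)
    have h : qInt (q : k) (n + 2) ≠ 0 := by
      rw [Ne, qInt_eq_zero_iff hq hd, show n + 2 = n.succ + 1 by omega,
        Nat.dvd_add_right dvd_rfl, Nat.dvd_one]
      omega
    rw [Nat.succ_eq_add_one, intervalCls_one_mul h, intervalCls_mul_one h]
  let s : Set (GreenRing k (LinearQuiverHopf k q)) :=
    {x | (∃ i, intervalCls q i 0 = x) ∨ intervalCls q 0 1 = x ∨ intervalCls q 0 d = x}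
  have hs : Subring.centralizer s = ⊤ := by
    refine subring_eq_top hd hq _ ?_ ?_ ?_
    · rintro i _ (⟨j, rfl⟩ | rfl | rfl)
      · exact hx j i 0
      · exact (hx i 0 1).symm
      · exact (hx i 0 d).symm
    · rintro _ (⟨j, rfl⟩ | rfl | rfl)
      · exact hx j 0 1
      · rfl
      · exact hyz.symm
    · rintro _ (⟨j, rfl⟩ | rfl | rfl)
      · exact hx j 0 d
      · exact hyz
      · rfl
  -- Every element commutes with the generators, so the generators are central, and generation
  -- applies a second time, to the center.
  have hc : ∀ g ∈ s, ∀ b, b * g = g * b := fun g hg b =>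
    ((Subring.mem_centralizer_iff.1 (hs ▸ Subring.mem_top b : b ∈ Subring.centralizer s)) g hg).symm
  have ht : Subring.center (GreenRing k (LinearQuiverHopf k q)) = ⊤ := by
    refine subring_eq_top hd hq _ ?_ ?_ ?_
    · exact fun i => Subring.mem_center_iff.2 (hc _ (Or.inl ⟨i, rfl⟩))
    · exact Subring.mem_center_iff.2 (hc _ (Or.inr (Or.inl rfl)))
    · exact Subring.mem_center_iff.2 (hc _ (Or.inr (Or.inr rfl)))
  exact Subring.mem_center_iff.1 (ht ▸ Subring.mem_top b) a

/-- For an index (n, i) with n maximal in a relation, the rank of the path of length n from g^i is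
one on that monomial. It vanishes on the others, whose bounds leave no room for this path. -/
theorem linearIndependent_monomialCls [CharZero k] (hd : 2 ≤ d)
    (hq : IsPrimitiveRoot (q : k) d) : LinearIndependent ℤ (monomialCls (k := k) q d) := by
  rw [linearIndependent_iff]
  intro c hc
  by_contra hne
  obtain ⟨⟨n, i⟩, hp, hmax⟩ := Finset.exists_max_image c.support Prod.fst
    (Finsupp.support_nonempty_iff.2 hne)
  choose V hV hVd using exists_isDominated_monomialCls (k := k) (q := q) hd hq
  obtain ⟨ρ, hρ⟩ := exists_opRank_hom (k := k) (q := q) i n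
  have h := congrArg ρ hc
  rw [Finsupp.linearCombination_apply, Finsupp.sum, map_sum, map_zero,
    Finset.sum_eq_single_of_mem _ hp] at h
  · rw [map_zsmul, ← hV, hρ, (hVd (n, i)).opRank_eq_one, Nat.cast_one, smul_eq_mul, mul_one] at h
    exact (Finsupp.mem_support_iff.1 hp) h
  · rintro ⟨m, j⟩ hm hne'
    rw [map_zsmul, ← hV, hρ, opRank_eq_zero_iff.2, Nat.cast_zero, smul_zero]
    by_contra h0
    have h1 := (hVd (m, j)).bounds _ _ h0
    have h2 := hmax _ hm
    dsimp only at h1 h2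
    exact hne' (Prod.ext (by dsimp only; omega) (by dsimp only; omega))

end

end GreenRing

/-! ### Chebyshev polynomials and the abstract presentation -/

section Presentation

variable {B : Type*} [CommRing B]

/-- The sequence of polynomials with `F 0 = 1`, `F 1 = y` and
`F (n + 2) = y * F (n + 1) - x * F n`. -/
def chebyshevSeq (x y : B) : ℕ → B
  | 0 => 1
  | 1 => y
  | n + 2 => y * chebyshevSeq x y (n + 1) - x * chebyshevSeq x y n

/-- The recursion is Pascal's rule. Any range longer than `l` is allowed, as the extra terms vanish;
this lets the three sums of the recursion be compared over one range. -/
theorem sum_eq_chebyshevSeq_of_lt (x y : B) (l : ℕ) : ∀ N, l < N →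
    ∑ i ∈ Finset.range N, (-1) ^ i * ((l - i).choose i : B) * x ^ i * y ^ (l - 2 * i)
      = chebyshevSeq x y l := by
  induction l using Nat.twoStepInduction with
  | zero =>
    rintro (_ | N) hN
    · omega
    rw [Finset.sum_range_succ', Finset.sum_eq_zero]
    · simp [chebyshevSeq]
    · simp
  | one =>
    rintro (_ | N) hN
    · omega
    rw [Finset.sum_range_succ', Finset.sum_eq_zero]
    · simp [chebyshevSeq]
    · intro i _
      simp [show 1 - (i + 1) = 0 by omega]
  | more l h0 h1 =>
    rintro (_ | N) hN
    · omega
    rw [chebyshevSeq, ← h1 (N + 1) (by omega), ← h0 N (by omega), Finset.sum_range_succ',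
      Finset.sum_range_succ' _ N, mul_add, Finset.mul_sum, Finset.mul_sum, add_sub_right_comm,
      ← Finset.sum_sub_distrib]
    congr 1
    · refine Finset.sum_congr rfl fun i _ => ?_
      have e1 : l + 2 - 2 * (i + 1) = l - 2 * i := by omega
      have e2 : l + 1 - (i + 1) = l - i := by omega
      have e3 : l + 2 - (i + 1) = l + 1 - i := by omega
      rw [e1, e2, e3]
      rcases lt_or_ge l i with hi | hi
      · rw [Nat.choose_eq_zero_of_lt (show l + 1 - i < i + 1 by omega),
          Nat.choose_eq_zero_of_lt (show l - i < i + 1 by omega),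
          Nat.choose_eq_zero_of_lt (show l - i < i by omega)]
        simp
      · rw [show l + 1 - i = l - i + 1 by omega, Nat.choose_succ_succ]
        rcases lt_or_ge l (2 * i + 1) with h | h
        · rw [Nat.choose_eq_zero_of_lt (show l - i < i.succ by omega)]
          push_cast
          ring
        · rw [show l - 2 * i = l + 1 - 2 * (i + 1) + 1 by omega]
          push_cast
          ring
    · simp
      ring

theorem sum_eq_chebyshevSeq (x y : B) (l : ℕ) :
    ∑ i ∈ Finset.range (l / 2 + 1), (-1) ^ i * ((l - i).choose i : B) * x ^ i * y ^ (l - 2 * i)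
      = chebyshevSeq x y l := by
  rw [← sum_eq_chebyshevSeq_of_lt x y l (l + 1) l.lt_succ_self]
  refine Finset.sum_subset (Finset.range_mono (by omega)) fun i _ hi => ?_
  rw [Finset.mem_range] at hi
  rw [Nat.choose_eq_zero_of_lt (by omega)]
  simp

theorem map_chebyshevSeq {A : Type*} [CommRing A] (f : B →+* A) (x y : B) (l : ℕ) :
    f (chebyshevSeq x y l) = chebyshevSeq (f x) (f y) l := by
  induction l using Nat.twoStepInduction with
  | zero => exact map_one f
  | one => rfl
  | more l h0 h1 => rw [chebyshevSeq, map_sub, map_mul, map_mul, h0, h1, chebyshevSeq]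

/-- The additive span of the products `X j * y ^ a` with `a < n`. -/
def powSpan (X : ℤ → B) (y : B) (n : ℕ) : Submodule ℤ B :=
  Submodule.span ℤ {b | ∃ j a, a < n ∧ X j * y ^ a = b}

theorem powSpan_mono (X : ℤ → B) (y : B) {m n : ℕ} (h : m ≤ n) :
    powSpan X y m ≤ powSpan X y n :=
  Submodule.span_mono (by
    rintro _ ⟨j, a, ha, rfl⟩
    exact ⟨j, a, by omega, rfl⟩)

theorem mul_mem_of_mem_span {s : Set B} {S : Submodule ℤ B} {b c : B}
    (hc : c ∈ Submodule.span ℤ s) (h : ∀ x ∈ s, b * x ∈ S) : b * c ∈ S := by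
  have : Submodule.span ℤ s ≤ S.comap (LinearMap.mulLeft ℤ b) := Submodule.span_le.2 h
  exact this hc

theorem mul_mem_powSpan (X : ℤ → B) (y : B) {n : ℕ} {b : B} (hb : b ∈ powSpan X y n) :
    y * b ∈ powSpan X y (n + 1) := by
  refine mul_mem_of_mem_span hb ?_
  rintro _ ⟨j, a, ha, rfl⟩
  exact Submodule.subset_span ⟨j, a + 1, by omega, by ring⟩

theorem coeff_mul_mem_powSpan {X : ℤ → B} (hX : ∀ i j, X i * X j = X (i + j)) (y : B) {n : ℕ}
    (i : ℤ) {b : B} (hb : b ∈ powSpan X y n) : X i * b ∈ powSpan X y n := by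
  refine mul_mem_of_mem_span hb ?_
  rintro _ ⟨j, a, ha, rfl⟩
  exact Submodule.subset_span ⟨i + j, a, ha, by rw [← hX, mul_assoc]⟩

/-- The polynomial is monic in y, with lower coefficients in the span of the `X j`; this makes the
relation one that rewrites y ^ d. -/
theorem chebyshevSeq_sub_pow_mem {X : ℤ → B} (hX : ∀ i j, X i * X j = X (i + j))
    (y : B) (l : ℕ) : chebyshevSeq (X 1) y l - y ^ l ∈ powSpan X y l := by
  induction l using Nat.twoStepInduction with
  | zero => simp [chebyshevSeq]
  | one => simp [chebyshevSeq]
  | more l ih0 ih1 =>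
    have e : chebyshevSeq (X 1) y (l + 2) - y ^ (l + 2)
        = y * (chebyshevSeq (X 1) y (l + 1) - y ^ (l + 1))
          - X 1 * (chebyshevSeq (X 1) y l - y ^ l) - X 1 * y ^ l := by
      rw [chebyshevSeq]
      ring
    rw [e]
    refine sub_mem (sub_mem (mul_mem_powSpan X y ih1) ?_) ?_
    · exact powSpan_mono X y (by omega) (coeff_mul_mem_powSpan hX y 1 ih0)
    · exact Submodule.subset_span ⟨1, l, by omega, rfl⟩

theorem pow_mem_powSpan {X : ℤ → B} (hX : ∀ i j, X i * X j = X (i + j)) (h0 : X 0 = 1)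
    {y : B} {l : ℕ} (h : (y - X 1 - 1) * chebyshevSeq (X 1) y l = 0) :
    y ^ (l + 1) ∈ powSpan X y (l + 1) := by
  set c := chebyshevSeq (X 1) y l - y ^ l with hc
  have hmem : c ∈ powSpan X y l := chebyshevSeq_sub_pow_mem hX y l
  have hmem' : c ∈ powSpan X y (l + 1) := powSpan_mono X y l.le_succ hmem
  -- The relation expanded with the Chebyshev polynomial written as c + y ^ l and solved for the
  -- leading power.
  have e : y ^ (l + 1) = X 1 * c + c - y * c + X 1 * y ^ l + X 0 * y ^ l := by
    have : chebyshevSeq (X 1) y l = c + y ^ l := by rw [hc]; ring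
    rw [this] at h
    rw [h0]
    linear_combination h
  rw [e]
  refine add_mem (add_mem (sub_mem (add_mem ?_ hmem') (mul_mem_powSpan X y hmem)) ?_) ?_
  · exact coeff_mul_mem_powSpan hX y 1 hmem'
  · exact Submodule.subset_span ⟨1, l, l.lt_succ_self, rfl⟩
  · exact Submodule.subset_span ⟨0, l, l.lt_succ_self, rfl⟩

/-- The monomials in which the exponent of `y` is less than `d`. -/
def reducedMonomial (X : ℤ → B) (y z : B) (d : ℕ) (p : ℕ × ℤ) : B :=
  X p.2 * z ^ (p.1 / d) * y ^ (p.1 % d)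

/-- The span contains 1 and is stable under multiplication by the generators; only multiplication by
y can raise its exponent to d, and then the relation lowers it again. -/
theorem span_reducedMonomial_eq_top {X : ℤ → B} (hX : ∀ i j, X i * X j = X (i + j))
    (h0 : X 0 = 1) {y z : B} {d : ℕ} (hd : d ≠ 0)
    (h : (y - X 1 - 1) * chebyshevSeq (X 1) y (d - 1) = 0)
    (hB : ∀ S : Subring B, (∀ i, X i ∈ S) → y ∈ S → z ∈ S → S = ⊤) :
    Submodule.span ℤ (Set.range (reducedMonomial X y z d)) = ⊤ := by
  set S := Submodule.span ℤ (Set.range (reducedMonomial X y z d)) with hS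
  have hmono : ∀ i b a, a < d → X i * z ^ b * y ^ a ∈ S := fun i b a ha => by
    refine Submodule.subset_span ⟨(b * d + a, i), ?_⟩
    have h1 : (b * d + a) / d = b := by
      rw [mul_comm, Nat.mul_add_div (by omega), Nat.div_eq_of_lt ha, add_zero]
    have h2 : (b * d + a) % d = a := by rw [Nat.mul_add_mod', Nat.mod_eq_of_lt ha]
    rw [reducedMonomial, h1, h2]
  have hpow : y ^ d ∈ powSpan X y d := by
    have := pow_mem_powSpan hX h0 h
    rwa [Nat.sub_add_cancel (by omega)] at this
  have hx : ∀ i, ∀ s ∈ S, X i * s ∈ S := by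
    intro i s hs
    refine mul_mem_of_mem_span hs ?_
    rintro _ ⟨⟨n, j⟩, rfl⟩
    rw [reducedMonomial, ← mul_assoc, ← mul_assoc, hX]
    exact hmono _ _ _ (Nat.mod_lt _ (by omega))
  have hz : ∀ s ∈ S, z * s ∈ S := by
    intro s hs
    refine mul_mem_of_mem_span hs ?_
    rintro _ ⟨⟨n, j⟩, rfl⟩
    have e : z * reducedMonomial X y z d (n, j) = X j * z ^ (n / d + 1) * y ^ (n % d) := by
      rw [reducedMonomial]
      ring
    rw [e]
    exact hmono _ _ _ (Nat.mod_lt _ (by omega))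
  have hy : ∀ s ∈ S, y * s ∈ S := by
    intro s hs
    refine mul_mem_of_mem_span hs ?_
    rintro _ ⟨⟨n, j⟩, rfl⟩
    have e : y * reducedMonomial X y z d (n, j) = X j * z ^ (n / d) * y ^ (n % d + 1) := by
      rw [reducedMonomial]
      ring
    rw [e]
    rcases (Nat.succ_le_of_lt (Nat.mod_lt n (show d > 0 by omega))).eq_or_lt with hn | hn
    · rw [Nat.succ_eq_add_one] at hn
      rw [hn]
      refine mul_mem_of_mem_span hpow ?_
      rintro _ ⟨i, a, ha, rfl⟩
      have e : X j * z ^ (n / d) * (X i * y ^ a) = X (j + i) * z ^ (n / d) * y ^ a := by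
        rw [← hX]
        ring
      rw [e]
      exact hmono _ _ _ ha
    · exact hmono _ _ _ hn
  -- The elements that multiply the span into itself form a subring; it contains the generators,
  -- hence is everything.
  let T : Subring B :=
    { carrier := {b | ∀ s ∈ S, b * s ∈ S}
      mul_mem' := fun {a b} ha hb s hs => by rw [mul_assoc]; exact ha _ (hb _ hs)
      one_mem' := fun s hs => by rwa [one_mul]
      add_mem' := fun {a b} ha hb s hs => by rw [add_mul]; exact add_mem (ha _ hs) (hb _ hs)
      zero_mem' := fun s _ => by rw [zero_mul]; exact zero_mem S
      neg_mem' := fun {a} ha s hs => by rw [neg_mul]; exact neg_mem (ha _ hs) }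
  have hT : T = ⊤ := hB T hx hy hz
  have h1 : (1 : B) ∈ S := by
    have := hmono 0 0 0 (by omega)
    rwa [h0, pow_zero, pow_zero, one_mul, one_mul] at this
  refine eq_top_iff.2 fun b _ => ?_
  have hb : b ∈ T := hT ▸ Subring.mem_top b
  have := hb 1 h1
  rwa [mul_one] at this

open LaurentPolynomial in
theorem mvPolynomial_subring_eq_top
    (S : Subring (MvPolynomial (Fin 2) (LaurentPolynomial ℤ)))
    (hx : ∀ i, MvPolynomial.C (T i) ∈ S) (hy : ∀ j, MvPolynomial.X j ∈ S) : S = ⊤ := by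
  refine eq_top_iff.2 fun p _ => ?_
  induction p using MvPolynomial.induction_on with
  | C a =>
    induction a using LaurentPolynomial.induction_on' with
    | add p q hp hq =>
      rw [map_add]
      exact add_mem (hp (Subring.mem_top _)) (hq (Subring.mem_top _))
    | C_mul_T n a =>
      rw [map_mul]
      refine mul_mem ?_ (hx n)
      have : (MvPolynomial.C (LaurentPolynomial.C a) : MvPolynomial (Fin 2) (LaurentPolynomial ℤ))
          = (a : MvPolynomial (Fin 2) (LaurentPolynomial ℤ)) := by simp
      rw [this]
      exact intCast_mem S a
  | add p q hp hq => exact add_mem (hp (Subring.mem_top _)) (hq (Subring.mem_top _))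
  | mul_X p j hp => exact mul_mem (hp (Subring.mem_top _)) (hy j)

open LaurentPolynomial in
/-- A commutative ring with generators `X i`, `y`, `z` that satisfy the Chebyshev relation is
presented by this relation if the reduced monomials are linearly independent. -/
theorem nonempty_ringEquiv_quotient {A : Type*} [CommRing A] {X : ℤ → A}
    (hX : ∀ i j, X i * X j = X (i + j)) (h0 : X 0 = 1) {y z : A} {d : ℕ} (hd : d ≠ 0)
    (h : (y - X 1 - 1) * chebyshevSeq (X 1) y (d - 1) = 0)
    (hA : ∀ S : Subring A, (∀ i, X i ∈ S) → y ∈ S → z ∈ S → S = ⊤)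
    (hli : LinearIndependent ℤ (reducedMonomial X y z d)) :
    Nonempty (A ≃+* (MvPolynomial (Fin 2) (LaurentPolynomial ℤ) ⧸
      Ideal.span {((MvPolynomial.X 0 - MvPolynomial.C (T 1) - 1) *
        chebyshevSeq (MvPolynomial.C (T 1)) (MvPolynomial.X 0) (d - 1) :
          MvPolynomial (Fin 2) (LaurentPolynomial ℤ))})) := by
  let Xhom : Multiplicative ℤ →* A :=
    { toFun := fun i => X i.toAdd
      map_one' := h0
      map_mul' := fun i j => (hX _ _).symm }
  let f : LaurentPolynomial ℤ →+* A := (AddMonoidAlgebra.lift ℤ A ℤ Xhom).toRingHom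
  have hf : ∀ i, f (T i) = X i := fun i => by
    refine (AddMonoidAlgebra.lift_single Xhom i (1 : ℤ)).trans ?_
    rw [one_smul]
    rfl
  let Φ : MvPolynomial (Fin 2) (LaurentPolynomial ℤ) →+* A := MvPolynomial.eval₂Hom f ![y, z]
  have hΦx : ∀ i, Φ (MvPolynomial.C (T i)) = X i := fun i => by
    simp only [Φ, MvPolynomial.coe_eval₂Hom, MvPolynomial.eval₂_C, hf]
  have hΦy : Φ (MvPolynomial.X 0) = y := by simp [Φ]
  have hΦz : Φ (MvPolynomial.X 1) = z := by simp [Φ]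
  set g : MvPolynomial (Fin 2) (LaurentPolynomial ℤ) :=
    (MvPolynomial.X 0 - MvPolynomial.C (T 1) - 1) *
      chebyshevSeq (MvPolynomial.C (T 1)) (MvPolynomial.X 0) (d - 1) with hg
  have hΦg : Φ g = 0 := by
    rw [hg, map_mul, map_sub, map_sub, map_one, map_chebyshevSeq, hΦx, hΦy, h]
  have hker : ∀ a ∈ Ideal.span {g}, Φ a = 0 := by
    intro a ha
    obtain ⟨b, rfl⟩ := Ideal.mem_span_singleton'.1 ha
    rw [map_mul, hΦg, mul_zero]
  let π := Ideal.Quotient.mk (Ideal.span {g})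
  let Ψ : (MvPolynomial (Fin 2) (LaurentPolynomial ℤ) ⧸ Ideal.span {g}) →+* A :=
    Ideal.Quotient.lift _ Φ hker
  have hΨ : ∀ a, Ψ (π a) = Φ a := fun a => Ideal.Quotient.lift_mk _ _ _
  have hsurj : Function.Surjective Ψ := by
    rw [← RingHom.range_eq_top]
    refine hA _ (fun i => ⟨π (MvPolynomial.C (T i)), ?_⟩) ⟨π (MvPolynomial.X 0), ?_⟩
      ⟨π (MvPolynomial.X 1), ?_⟩
    · rw [hΨ, hΦx]
    · rw [hΨ, hΦy]
    · rw [hΨ, hΦz]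
  have hspan := span_reducedMonomial_eq_top (X := fun i => π (MvPolynomial.C (T i)))
    (y := π (MvPolynomial.X 0)) (z := π (MvPolynomial.X 1)) (d := d)
    (fun i j => by rw [← map_mul, ← map_mul, ← T_add]) (by rw [T_zero, map_one, map_one]) hd
    (by
      rw [← map_chebyshevSeq, ← map_one π, ← map_sub, ← map_sub, ← map_mul]
      exact Ideal.Quotient.eq_zero_iff_mem.2 (Ideal.mem_span_singleton_self g))
    (by
      intro S hx hy hz
      have h1 : S.comap π = ⊤ := mvPolynomial_subring_eq_top _ hx (by
        intro j
        fin_cases j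
        · exact hy
        · exact hz)
      refine eq_top_iff.2 fun b _ => ?_
      obtain ⟨a, rfl⟩ := Ideal.Quotient.mk_surjective b
      have h2 : a ∈ S.comap π := h1 ▸ Subring.mem_top a
      exact h2)
  have hinj : Function.Injective Ψ := by
    rw [injective_iff_map_eq_zero]
    intro b hb
    have hmem : b ∈ Submodule.span ℤ (Set.range (reducedMonomial
      (fun i => π (MvPolynomial.C (T i))) (π (MvPolynomial.X 0)) (π (MvPolynomial.X 1)) d)) := by
      rw [hspan]
      exact Submodule.mem_top
    obtain ⟨c, rfl⟩ := Finsupp.mem_span_range_iff_exists_finsupp.1 hmem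
    -- Applying Ψ turns the expansion of an element of the kernel into a linear relation between the
    -- reduced monomials of `A`.
    have hc : c = 0 := by
      rw [linearIndependent_iff] at hli
      refine hli c ?_
      rw [Finsupp.linearCombination_apply, ← hb, Finsupp.sum, Finsupp.sum, map_sum]
      refine Finset.sum_congr rfl fun p _ => ?_
      rw [map_zsmul, reducedMonomial, reducedMonomial, map_mul, map_mul, map_pow, map_pow, hΨ,
        hΨ, hΨ, hΦx, hΦy, hΦz]
    rw [hc, Finsupp.sum_zero_index]
  exact ⟨(RingEquiv.ofBijective Ψ ⟨hinj, hsurj⟩).symm⟩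

end Presentation

/-! ### The Chebyshev relation in the Green ring -/

namespace GreenRing

open LinearQuiverHopf FDComod

variable {k : Type u} [Field k] {q : kˣ} {d : ℕ}

/-- The Green ring of the linear quiver at a root of unity is commutative. -/
abbrev commRing [CharZero k] (hd : 2 ≤ d) (hq : IsPrimitiveRoot (q : k) d) :
    CommRing (GreenRing k (LinearQuiverHopf k q)) :=
  { (inferInstance : Ring (GreenRing k (LinearQuiverHopf k q))) with
    mul_comm := green_mul_comm hd hq }

/-- The Clebsch–Gordan rule, solved for the longer interval, is the Chebyshev recursion; it is
available as long as the q-integers up to `l` are nonzero. -/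
theorem intervalCls_eq_chebyshevSeq [CharZero k] (hd : 2 ≤ d) (hq : IsPrimitiveRoot (q : k) d)
    {l : ℕ} (hl : l < d) : intervalCls q 0 l
      = @chebyshevSeq _ (commRing hd hq) (intervalCls q 1 0) (intervalCls q 0 1) l := by
  induction l using Nat.twoStepInduction with
  | zero => exact intervalCls_zero_zero
  | one => rfl
  | more l h0 h1 =>
    have h : qInt (q : k) (l + 2) ≠ 0 := by
      rw [Ne, qInt_eq_zero_iff hq hd]
      intro h
      have := Nat.le_of_dvd (by omega) h
      omega
    have h2 := intervalCls_one_mul h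
    have h3 := intervalCls_zero_mul (k := k) (q := q) 1 0 l
    rw [add_zero] at h3
    rw [← h3, ← sub_eq_iff_eq_add, h0 (by omega), h1 (by omega)] at h2
    exact h2.symm

/-- The Chebyshev factor is the class of M(0, d - 1), and the q-integer of d vanishes, so the
degenerate rule applies. -/
theorem chebyshev_relation [CharZero k] (hd : 2 ≤ d) (hq : IsPrimitiveRoot (q : k) d) :
    (intervalCls q 0 1 - intervalCls q 1 0 - 1) *
      @chebyshevSeq _ (commRing hd hq) (intervalCls q 1 0) (intervalCls q 0 1) (d - 1) = 0 := by
  rw [← intervalCls_eq_chebyshevSeq hd hq (by omega), sub_mul, sub_mul, one_mul,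
    intervalCls_one_mul_of_qInt_eq_zero, intervalCls_zero_mul, add_zero, add_sub_cancel_right,
    sub_self]
  rw [qInt_eq_zero_iff hq hd, Nat.sub_add_cancel (by omega)]

end GreenRing

end

theorem theorem4p14 {k : Type u} [Field k] [IsAlgClosed k] [CharZero k] (q : kˣ) (d : ℕ)
    (hd : 2 ≤ d) (hq : orderOf q = d)
    (x y : MvPolynomial (Fin 2) (LaurentPolynomial ℤ))
    (hx : x = MvPolynomial.C (LaurentPolynomial.T 1)) (hy : y = MvPolynomial.X 0) :
    Nonempty (GreenRing k (LinearQuiverHopf k q) ≃+*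
      (MvPolynomial (Fin 2) (LaurentPolynomial ℤ) ⧸
        Ideal.span {(y - x - 1) * ∑ i ∈ Finset.range ((d - 1) / 2 + 1),
          (-1) ^ i * ((d - 1 - i).choose i : MvPolynomial (Fin 2) (LaurentPolynomial ℤ)) *
            x ^ i * y ^ (d - 1 - 2 * i)})) := by
  have hq' := GreenRing.isPrimitiveRoot_of_orderOf hq
  rw [sum_eq_chebyshevSeq, hx, hy]
  exact @nonempty_ringEquiv_quotient (GreenRing k (LinearQuiverHopf k q))
    (GreenRing.commRing hd hq') (fun i => GreenRing.intervalCls q i 0)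
    (fun i j => GreenRing.intervalCls_zero_mul i j 0) GreenRing.intervalCls_zero_zero
    (GreenRing.intervalCls q 0 1) (GreenRing.intervalCls q 0 d) d (by omega)
    (GreenRing.chebyshev_relation hd hq')
    (fun S => GreenRing.subring_eq_top hd hq' S)
    (GreenRing.linearIndependent_monomialCls hd hq')
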